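/- Let $\Gamma:\mathbb{R}\to\mathbb{R}$ be $2\pi$-periodic and twice differentiable on $(0,2\pi)$, with either $\Gamma'>0$ on all of $(0,2\pi)$ or $\Gamma'<0$ on all of $(0,2\pi)$ (the value $\Gamma(0)$ is arbitrary), and with curvature of constant sign: either $\Gamma''\ge 0$ on $(0,2\pi)$ or $\Gamma''\le 0$ on $(0,2\pi)$. Let $N\ge 1$, $\omega\in\mathbb{R}$, and consider the $N$ monotone phase-coupled oscillators $$\dot\theta_k=\omega+\sum_{j\ne k}\Gamma(\theta_k-\theta_j),\qquad k=1,\dots,N,$$ with phases taken modulo $2\pi$. Since the right-hand side is discontinuous where two phases coincide, a solution on $[0,\infty)$ means a function satisfying the integrated equation $\theta_k(t)=\theta_k(0)+\int_0^t\bigl(\omega+\sum_{j\ne k}\Gamma(\theta_k(s)-\theta_j(s))\bigr)\,ds$ with integrable integrand, along which two oscillators that have synchronized (equal phases modulo $2\pi$) remain synchronized forever. Then for Lebesgue-almost every initial condition a solution exists, and the following holds. (1) If $\Gamma$ is strictly decreasing on $(0,2\pi)$, then for almost every initial condition the oscillators can be relabelled, keeping oscillator $1$, so that the initial phase differences $\tilde\theta_k=\theta_{k+1}-\theta_1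 \bmod 2\pi\in[0,2\pi)$ satisfy $0<\tilde\theta_1<\dots<\tilde\theta_{N-1}<2\pi$, and with this labelling every solution satisfies $\tilde\theta_k(t)\to 2\pi k/N$ as $t\to\infty$ for $k=1,\dots,N-1$ (the splay state). Moreover, the splay state is the unique equilibrium of the dynamics of $(\tilde\theta_1,\dots,\tilde\theta_{N-1})$ in the region $0<\tilde\theta_1<\dots<\tilde\theta_{N-1}<2\pi$. (2) If $\Gamma$ is strictly increasing on $(0,2\pi)$, then for almost every initial condition every solution achieves full synchronization in finite time: there is $T\ge 0$ such that $\theta_1(t)=\dots=\theta_N(t)$ modulo $2\pi$ for all $t\ge T$. This happens through at most $N-1$ successive pairwise synchronizations: there are at most $N-1$ times $t>0$ at which some pair of oscillators becomes synchronized. -/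

import Mathlib

open Real Set Filter Topology MeasureTheory

noncomputable section

/-- A coupling function of monotone oscillators: it is `2π`-periodic, differentiable on `(0, 2π)`,
and its derivative is everywhere positive or everywhere negative on `(0, 2π)`. Nothing is assumed
at the multiples of `2π`, where such a function is necessarily discontinuous; in particular the
value `Γ 0` is arbitrary. -/
structure IsMonotoneCoupling (Γ : ℝ → ℝ) : Prop where
  periodic : Function.Periodic Γ (2 * π)
  differentiableAt : ∀ x ∈ Ioo 0 (2 * π), DifferentiableAt ℝ Γ x
  deriv_sign : (∀ x ∈ Ioo 0 (2 * π), 0 < deriv Γ x) ∨ (∀ x ∈ Ioo 0 (2 * π), deriv Γ x < 0)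

/-- The curvature `Γ''` exists and has a constant (weak) sign on `(0, 2π)`. -/
structure HasCurvatureOfConstantSign (Γ : ℝ → ℝ) : Prop where
  differentiableAt_deriv : ∀ x ∈ Ioo 0 (2 * π), DifferentiableAt ℝ (deriv Γ) x
  curvature_sign : (∀ x ∈ Ioo 0 (2 * π), 0 ≤ deriv (deriv Γ) x) ∨
    (∀ x ∈ Ioo 0 (2 * π), deriv (deriv Γ) x ≤ 0)

/-- The right-hand side `ω + ∑_{j ≠ k} Γ (θ_k - θ_j)` of the phase dynamics. Points of the torus
are represented by real phases; by periodicity of `Γ` the representatives do not matter. -/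
def phaseVelocity {N : ℕ} (Γ : ℝ → ℝ) (ω : ℝ) (θ : Fin N → ℝ) (k : Fin N) : ℝ :=
  ω + ∑ j ∈ Finset.univ.erase k, Γ (θ k - θ j)

/-- Two phases are the same point of the circle `ℝ / 2πℤ`. -/
def InPhase (a b : ℝ) : Prop := (a : Real.Angle) = (b : Real.Angle)

/-- The phase difference `a - b` on the circle, represented in `[0, 2π)`. -/
def phaseDiff (a b : ℝ) : ℝ := toIcoMod Real.two_pi_pos 0 (a - b)

/-- `θ` is a solution, on `[0, ∞)`, of the network of coupled phase oscillators, starting from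
`θ₀`. The right-hand side is discontinuous where two oscillators have the same phase, so the
differential equation is understood in the sense of Carathéodory (integral form), and its
continuation through a synchronization is the one for identical oscillators: two synchronized
oscillators remain synchronized forever. -/
structure IsNetworkSolution {N : ℕ} (Γ : ℝ → ℝ) (ω : ℝ) (θ₀ : Fin N → ℝ)
    (θ : ℝ → Fin N → ℝ) : Prop where
  intervalIntegrable : ∀ t : ℝ, 0 ≤ t → ∀ k,
    IntervalIntegrable (fun s => phaseVelocity Γ ω (θ s) k) volume 0 t
  eq_integral : ∀ t : ℝ, 0 ≤ t → ∀ k,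
    θ t k = θ₀ k + ∫ s in (0 : ℝ)..t, phaseVelocity Γ ω (θ s) k
  inPhase_forever : ∀ s t : ℝ, 0 ≤ s → s ≤ t → ∀ i j,
    InPhase (θ s i) (θ s j) → InPhase (θ t i) (θ t j)

/-- The positive times at which some pair of oscillators synchronizes, i.e. is in phase for the
first time. -/
def synchronizationTimes {N : ℕ} (θ : ℝ → Fin N → ℝ) : Set ℝ :=
  {t | 0 < t ∧ ∃ i j, InPhase (θ t i) (θ t j) ∧
    ∀ s, 0 ≤ s → s < t → ¬ InPhase (θ s i) (θ s j)}

end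

/-! Everything rests on comparing two solutions `x`, `y` in the same cell, i.e. whose lifted
pairwise differences have the same integer parts in units of `2π`. Let `Γ` be decreasing. At an
index `i` where `y - x` is largest, each `y i - y j` is at least `x i - x j`, so the velocity of `y`
there is at most that of `x`: the largest displacement cannot grow, nor the smallest one shrink
(`IsCellSolution.sub_le`, `IsCellSolution.le_sub`). The interaction between the two extremal indices
even makes the spread of the displacements contract exponentially
(`IsCellSolution.exp_mul_sub_sub_le`). The rate comes from the curvature: `Γ'` is monotone, hence at
most `Γ' π < 0` on one half of `(0, 2π)`, and one of `u`, `2π - u` always lies in that half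
(`IsMonotoneCoupling.exists_isRepulsive`).

Decreasing coupling: cyclic relabelling maps an ordered solution to another solution in the same
cell, and the displacement between the two is the vector of gaps. So the smallest gap never
decreases and no collision occurs. Comparison with the uniformly rotating splay state gives
exponential convergence; the same contraction gives uniqueness of the equilibrium.

Increasing coupling: `-Γ` is repulsive, so the estimates hold backwards in time. A solution that
never leaves its cell, compared with its own time shifts, must be phase-locked
(`IsNetworkSolution.phaseLocked_of_cell_eq`). Any other solution collides, which lowers the number
of clusters; hence it ends up synchronized or locked with at least two clusters. Within one cell the
locked states lie on a single line, and pulling a set back through a collision adds only one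
parameter, the travel time, because the backward flow is nonexpansive (`IsThin.preimage_solution`).
At most `N - 2` collisions precede an unsynchronized locked state, so the bad initial conditions
have Hausdorff dimension at most `N - 1` and are null. For existence, the curvature bounds `Γ` on
one side, so a solution in a cell has a limit at its exit time and can be continued with fewer
clusters. -/

/-! ### Maximum principle and global integral curves -/

/-- A function with a negative derivative at `t` takes larger values immediately before `t`. -/
theorem HasDerivAt.exists_lt_of_neg {f : ℝ → ℝ} {f' a t : ℝ} (h : HasDerivAt f f' t)
    (hf' : f' < 0) (ha : a < t) : ∃ s ∈ Ioo a t, f t < f s := by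
  have h1 := (hasDerivAt_iff_tendsto_slope.1 h).eventually (gt_mem_nhds hf')
  have h2 : ∀ᶠ s in 𝓝[<] t, slope f t s < 0 :=
    h1.filter_mono (nhdsWithin_mono _ fun s hs => ne_of_lt hs)
  obtain ⟨s, hs, hst⟩ := (h2.and (Ioo_mem_nhdsLT ha)).exists
  refine ⟨s, hst, ?_⟩
  rw [slope_def_field, div_neg_iff] at hs
  rcases hs with hs | hs
  · linarith [hs.1]
  · linarith [hs.2, hst.2]

/-- Maximum principle for a finite family of functions: if whichever function is the largest one
satisfies `w' ≤ -c w`, then the maximum of the family decays at the exponential rate `c`. -/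
theorem exp_mul_le_of_forall_isMax {K : Type*} [Finite K] {w w' : ℝ → K → ℝ} {T c A : ℝ}
    (hcont : ∀ k, ContinuousOn (fun t => w t k) (Icc 0 T))
    (hderiv : ∀ t ∈ Ioo 0 T, ∀ k, HasDerivAt (fun s => w s k) (w' t k) t)
    (hmax : ∀ t ∈ Ioo 0 T, ∀ k, (∀ j, w t j ≤ w t k) → w' t k ≤ -c * w t k)
    (h0 : ∀ k, w 0 k ≤ A) : ∀ t ∈ Icc 0 T, ∀ k, exp (c * t) * w t k ≤ A := by
  have hexp : ∀ t, HasDerivAt (fun s => exp (c * s)) (exp (c * t) * c) t := fun t => by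
    simpa using ((hasDerivAt_id t).const_mul c).exp
  have hexpc : Continuous fun s : ℝ => exp (c * s) := by fun_prop
  have key : ∀ t ∈ Ioo 0 T, ∀ k, exp (c * t) * w t k ≤ A := by
    intro T' hT' k₁
    refine le_of_forall_pos_le_add fun ε hε => ?_
    have hT0 : 0 < T' := hT'.1
    -- Subtracting `δ * t` makes the differential inequality strict, so the joint maximum over `k`
    -- and time can only sit at time `0`; the cost at time `T'` is exactly `ε`.
    set δ := ε / T' with hδ
    have hδ0 : 0 < δ := div_pos hε hT0
    let g : K → ℝ → ℝ := fun k t => exp (c * t) * w t k - δ * t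
    have hg : ∀ k, ContinuousOn (g k) (Icc 0 T') := fun k =>
      (hexpc.continuousOn.mul ((hcont k).mono (Icc_subset_Icc_right hT'.2.le))).sub (by fun_prop)
    have hne : (Icc 0 T').Nonempty := ⟨0, le_rfl, hT0.le⟩
    have hM : ∀ k, ∃ t ∈ Icc 0 T', ∀ s ∈ Icc 0 T', g k s ≤ g k t := fun k => by
      obtain ⟨t, ht, h⟩ := isCompact_Icc.exists_isMaxOn hne (hg k)
      exact ⟨t, ht, fun s hs => h hs⟩
    choose τ hτ hτmax using hM
    have : Nonempty K := ⟨k₁⟩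
    obtain ⟨k₀, hk₀⟩ := Finite.exists_max fun k => g k (τ k)
    have hall : ∀ k, ∀ s ∈ Icc 0 T', g k s ≤ g k₀ (τ k₀) := fun k s hs =>
      (hτmax k s hs).trans (hk₀ k)
    have hτ0 : τ k₀ = 0 := by
      by_contra hne0
      have hpos : 0 < τ k₀ := lt_of_le_of_ne (hτ k₀).1 (Ne.symm hne0)
      have hmem : τ k₀ ∈ Ioo 0 T := ⟨hpos, (hτ k₀).2.trans_lt hT'.2⟩
      have hd : HasDerivAt (g k₀) (exp (c * τ k₀) * c * w (τ k₀) k₀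
          + exp (c * τ k₀) * w' (τ k₀) k₀ - δ) (τ k₀) := by
        have := ((hexp _).mul (hderiv _ hmem k₀)).sub ((hasDerivAt_id (τ k₀)).const_mul δ)
        rw [mul_one] at this
        exact this
      have hw : w' (τ k₀) k₀ ≤ -c * w (τ k₀) k₀ := by
        refine hmax _ hmem _ fun j => ?_
        have := hall j _ (hτ k₀)
        simp only [g] at this
        exact le_of_mul_le_mul_left (by linarith) (exp_pos (c * τ k₀))
      have hneg : exp (c * τ k₀) * c * w (τ k₀) k₀ + exp (c * τ k₀) * w' (τ k₀) k₀ - δ < 0 := by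
        nlinarith [mul_le_mul_of_nonneg_left hw (exp_pos (c * τ k₀)).le]
      obtain ⟨s, hs, hlt⟩ := hd.exists_lt_of_neg hneg hpos
      exact absurd (hτmax k₀ s ⟨hs.1.le, hs.2.le.trans (hτ k₀).2⟩) (not_le.2 hlt)
    have h1 := hall k₁ T' ⟨hT0.le, le_rfl⟩
    rw [hτ0] at h1
    simp only [g, mul_zero, exp_zero, one_mul, sub_zero] at h1
    have h2 : δ * T' = ε := by rw [hδ]; field_simp
    linarith [h0 k₀]
  intro t ht k
  rcases eq_or_lt_of_le ht.1 with rfl | h0t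
  · simpa using h0 k
  have hcl : IsClosed {s | s ∈ Icc 0 T ∧ exp (c * s) * w s k ≤ A} :=
    (hexpc.continuousOn.mul (hcont k)).preimage_isClosed_of_isClosed isClosed_Icc isClosed_Iic
  have hsub : Ioo 0 T ⊆ {s | s ∈ Icc 0 T ∧ exp (c * s) * w s k ≤ A} := fun s hs =>
    ⟨Ioo_subset_Icc_self hs, key s hs k⟩
  have := hcl.closure_subset_iff.2 hsub
  rw [closure_Ioo (h0t.trans_le ht.2).ne] at this
  exact (this ht).2

/-- A bounded and globally Lipschitz vector field has global integral curves. -/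
theorem LipschitzWith.exists_forall_hasDerivAt {E : Type*} [NormedAddCommGroup E]
    [NormedSpace ℝ E] [CompleteSpace E] {f : E → E} {K L : NNReal} (hf : LipschitzWith K f)
    (hL : ∀ x, ‖f x‖ ≤ L) (x : E) :
    ∃ y : ℝ → E, y 0 = x ∧ ∀ t, HasDerivAt y (f (y t)) t := by
  have hloc : ∀ T : NNReal, ∃ α : ℝ → E, α 0 = x ∧
      ∀ t ∈ Ioo (-T : ℝ) T, HasDerivAt α (f (α t)) t := by
    intro T
    have h0 : (0 : ℝ) ∈ Icc (-T : ℝ) T := ⟨by simp, T.2⟩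
    -- A field bounded by `L` cannot leave the ball of radius `L * T` within time `T`, so
    -- Picard–Lindelöf covers the whole interval.
    have hP : IsPicardLindelof (fun _ => f) (⟨0, h0⟩ : Icc (-T : ℝ) T) x (L * T) 0 L K :=
      IsPicardLindelof.of_time_independent (fun y _ => hL y) hf.lipschitzOnWith (by simp)
    obtain ⟨α, hα0, hα⟩ := hP.exists_eq_forall_mem_Icc_hasDerivWithinAt₀
    exact ⟨α, hα0, fun t ht => (hα t (Ioo_subset_Icc_self ht)).hasDerivAt (Icc_mem_nhds ht.1 ht.2)⟩
  choose α hα0 hα using hloc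
  have huniq : ∀ S T : NNReal, S ≤ T → EqOn (α S) (α T) (Ioo (-S : ℝ) S) := by
    intro S T hST t ht
    have hS : (0 : ℝ) < S := by have := ht.1.trans ht.2; linarith
    have hST' : (S : ℝ) ≤ T := hST
    exact ODE_solution_unique_of_mem_Ioo (v := fun _ => f) (s := fun _ => univ) (K := K) (t₀ := 0)
      (fun _ _ => hf.lipschitzOnWith) ⟨by linarith, hS⟩ (fun s hs => ⟨hα S s hs, trivial⟩)
      (fun s hs => ⟨hα T s ⟨by linarith [hs.1], by linarith [hs.2]⟩, trivial⟩)
      (by rw [hα0, hα0]) ht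
  refine ⟨fun t => α (‖t‖₊ + 1) t, hα0 _, fun t => ?_⟩
  have heq : ∀ s ∈ Ioo (-(‖t‖ + 1)) (‖t‖ + 1), α (‖s‖₊ + 1) s = α (‖t‖₊ + 2) s := by
    intro s hs
    refine huniq _ _ ?_ ?_
    · have : ‖s‖ ≤ ‖t‖ + 1 := (abs_lt.2 hs).le
      have h2 : ‖s‖₊ ≤ ‖t‖₊ + 1 := this
      calc ‖s‖₊ + 1 ≤ ‖t‖₊ + 1 + 1 := by gcongr
        _ = ‖t‖₊ + 2 := by rw [add_assoc]; norm_num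
    · have := abs_lt.1 (show |s| < |s| + 1 by linarith)
      simpa using this
  have htm : t ∈ Ioo (-(‖t‖ + 1)) (‖t‖ + 1) := abs_lt.1 (show |t| < |t| + 1 by linarith)
  have hd := hα (‖t‖₊ + 2) t (by
    have := abs_lt.1 (show |t| < |t| + 2 by linarith)
    simpa using this)
  rw [← heq t htm] at hd
  refine hd.congr_of_eventuallyEq ?_
  filter_upwards [Ioo_mem_nhds htm.1 htm.2] with s hs using heq s hs

/-! ### The coupling function: contraction rate, one-sided bound, regularity -/

theorem IsMonotoneCoupling.neg {Γ : ℝ → ℝ} (h : IsMonotoneCoupling Γ) :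
    IsMonotoneCoupling fun x => -Γ x where
  periodic x := congrArg Neg.neg (h.periodic x)
  differentiableAt x hx := (h.differentiableAt x hx).neg
  deriv_sign := by
    simp only [deriv.fun_neg]
    rcases h.deriv_sign with h | h
    · exact Or.inr fun x hx => by simpa using h x hx
    · exact Or.inl fun x hx => by simpa using h x hx

theorem HasCurvatureOfConstantSign.neg {Γ : ℝ → ℝ} (h : HasCurvatureOfConstantSign Γ) :
    HasCurvatureOfConstantSign fun x => -Γ x := by
  have hd : deriv (fun x => -Γ x) = fun x => -deriv Γ x := by ext x; simp
  constructor
  · intro x hx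
    rw [hd]
    exact (h.differentiableAt_deriv x hx).neg
  · simp only [hd, deriv.fun_neg]
    rcases h.curvature_sign with h | h
    · exact Or.inr fun x hx => by simpa using h x hx
    · exact Or.inl fun x hx => by simpa using h x hx

/-- A `2π`-periodic coupling that is nonincreasing on `(0, 2π)` and whose symmetrization decreases
at least at the linear rate `c`. -/
structure IsRepulsive (Γ : ℝ → ℝ) (c : ℝ) : Prop where
  periodic : Function.Periodic Γ (2 * π)
  pos : 0 < c
  antitoneOn : AntitoneOn Γ (Ioo 0 (2 * π))
  rate : ∀ u v, 0 < u → u ≤ v → v < 2 * π →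
    c * (v - u) ≤ (Γ u - Γ v) + (Γ (2 * π - v) - Γ (2 * π - u))

theorem IsMonotoneCoupling.deriv_neg_of_strictAntiOn {Γ : ℝ → ℝ} (h : IsMonotoneCoupling Γ)
    (hs : StrictAntiOn Γ (Ioo 0 (2 * π))) : ∀ x ∈ Ioo 0 (2 * π), deriv Γ x < 0 := by
  rcases h.deriv_sign with h1 | h1
  · exfalso
    have hm : StrictMonoOn Γ (Ioo 0 (2 * π)) := strictMonoOn_of_deriv_pos (convex_Ioo _ _)
      (fun x hx => (h.differentiableAt x hx).continuousAt.continuousWithinAt)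
      (by rwa [interior_Ioo])
    have h2 : π / 2 ∈ Ioo 0 (2 * π) := ⟨by positivity, by linarith [pi_pos]⟩
    have h3 : π ∈ Ioo 0 (2 * π) := ⟨by positivity, by linarith [pi_pos]⟩
    have h4 : π / 2 < π := by linarith [pi_pos]
    exact lt_asymm (hm h2 h3 h4) (hs h2 h3 h4)
  · exact h1

/-- If `Γ' ≤ -c` on a convex part `s` of the interval, then `Γ` decreases there at rate `c`. -/
theorem IsMonotoneCoupling.mul_sub_le {Γ : ℝ → ℝ} (h : IsMonotoneCoupling Γ) {c : ℝ} {s : Set ℝ}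
    (hs : Convex ℝ s) (hsub : s ⊆ Ioo 0 (2 * π)) (hc : ∀ x ∈ s, deriv Γ x ≤ -c)
    {u v : ℝ} (hu : u ∈ s) (hv : v ∈ s) (huv : u ≤ v) : c * (v - u) ≤ Γ u - Γ v := by
  have := hs.image_sub_le_mul_sub_of_deriv_le (f := Γ) (C := -c)
    (fun x hx => (h.differentiableAt x (hsub hx)).continuousAt.continuousWithinAt)
    (fun x hx => (h.differentiableAt x (hsub (interior_subset hx))).differentiableWithinAt)
    (fun x hx => hc x (interior_subset hx)) u hu v hv huv
  linarith

/-- The rate is `-Γ' π`. Monotonicity of `Γ'` gives `Γ' ≤ Γ' π` on the left or the right half of the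
interval. The intervals `[u, v]` and `[2π - v, 2π - u]` are mirror images in `π`, so their parts in
that half have total length `v - u`; elsewhere it suffices that `Γ` decreases. -/
theorem IsMonotoneCoupling.exists_isRepulsive {Γ : ℝ → ℝ} (h : IsMonotoneCoupling Γ)
    (hcurv : HasCurvatureOfConstantSign Γ) (hs : StrictAntiOn Γ (Ioo 0 (2 * π))) :
    ∃ c, IsRepulsive Γ c := by
  have hneg := h.deriv_neg_of_strictAntiOn hs
  have hπ : π ∈ Ioo 0 (2 * π) := ⟨pi_pos, by linarith [pi_pos]⟩
  have hanti := hs.antitoneOn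
  have hcont : ContinuousOn (deriv Γ) (Ioo 0 (2 * π)) := fun x hx =>
    (hcurv.differentiableAt_deriv x hx).continuousAt.continuousWithinAt
  have hdiff : DifferentiableOn ℝ (deriv Γ) (interior (Ioo 0 (2 * π))) := by
    rw [interior_Ioo]
    exact fun x hx => (hcurv.differentiableAt_deriv x hx).differentiableWithinAt
  refine ⟨-deriv Γ π, h.periodic, by linarith [hneg π hπ], hanti, ?_⟩
  intro u v hu huv hv
  set c := -deriv Γ π with hc
  have mem : ∀ {x}, 0 < x → x < 2 * π → x ∈ Ioo 0 (2 * π) := fun h1 h2 => ⟨h1, h2⟩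
  rcases hcurv.curvature_sign with h1 | h1
  · have hmono : MonotoneOn (deriv Γ) (Ioo 0 (2 * π)) :=
      monotoneOn_of_deriv_nonneg (convex_Ioo _ _) hcont hdiff (by rwa [interior_Ioo])
    have hle : ∀ x ∈ Ioc 0 π, deriv Γ x ≤ -c := fun x hx => by
      rw [hc, neg_neg]; exact hmono (mem hx.1 (by linarith [hx.2, pi_pos])) hπ hx.2
    have hsub : Ioc 0 π ⊆ Ioo 0 (2 * π) := fun x hx => ⟨hx.1, by linarith [hx.2, pi_pos]⟩
    have key : ∀ {a b}, 0 < a → b ≤ π → a ≤ b → c * (b - a) ≤ Γ a - Γ b := fun ha hb hab =>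
      h.mul_sub_le (convex_Ioc 0 π) hsub hle ⟨ha, hab.trans hb⟩ ⟨ha.trans_le hab, hb⟩ hab
    rcases le_total v π with hvπ | hvπ
    · have := key hu hvπ huv
      have := hanti (mem (by linarith) (by linarith)) (mem (by linarith) (by linarith))
        (show 2 * π - v ≤ 2 * π - u by linarith)
      linarith
    · rcases le_total u π with huπ | huπ
      · have h2 := key hu le_rfl huπ
        have h3 := key (show 0 < 2 * π - v by linarith) le_rfl (by linarith)
        have h4 := hanti hπ (mem (by linarith) hv) hvπ
        have h5 := hanti hπ (mem (by linarith) (by linarith)) (show π ≤ 2 * π - u by linarith)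
        linarith
      · have := key (show 0 < 2 * π - v by linarith) (by linarith)
          (show 2 * π - v ≤ 2 * π - u by linarith)
        have := hanti (mem hu (by linarith)) (mem (by linarith) hv) huv
        linarith
  · have hmono : AntitoneOn (deriv Γ) (Ioo 0 (2 * π)) :=
      antitoneOn_of_deriv_nonpos (convex_Ioo _ _) hcont hdiff (by rwa [interior_Ioo])
    have hle : ∀ x ∈ Ico π (2 * π), deriv Γ x ≤ -c := fun x hx => by
      rw [hc, neg_neg]; exact hmono hπ (mem (by linarith [hx.1, pi_pos]) hx.2) hx.1
    have hsub : Ico π (2 * π) ⊆ Ioo 0 (2 * π) := fun x hx => ⟨by linarith [hx.1, pi_pos], hx.2⟩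
    have key : ∀ {a b}, π ≤ a → b < 2 * π → a ≤ b → c * (b - a) ≤ Γ a - Γ b := fun ha hb hab =>
      h.mul_sub_le (convex_Ico π (2 * π)) hsub hle ⟨ha, hab.trans_lt hb⟩ ⟨ha.trans hab, hb⟩ hab
    rcases le_total v π with hvπ | hvπ
    · have := key (show π ≤ 2 * π - v by linarith) (show 2 * π - u < 2 * π by linarith)
        (by linarith)
      have := hanti (mem hu (by linarith)) (mem (by linarith) hv) huv
      linarith
    · rcases le_total u π with huπ | huπ
      · have h2 := key le_rfl hv hvπ
        have h3 := key le_rfl (show 2 * π - u < 2 * π by linarith) (by linarith)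
        have h4 := hanti (mem hu (by linarith)) hπ huπ
        have h5 := hanti (mem (by linarith) (by linarith)) hπ (show 2 * π - v ≤ π by linarith)
        linarith
      · have := key huπ hv huv
        have := hanti (mem (by linarith) (by linarith)) (mem (by linarith) (by linarith))
          (show 2 * π - v ≤ 2 * π - u by linarith)
        linarith

theorem exists_mem_Ioo_sub_two_pi_mul (u : ℝ) (hu : ∀ n : ℤ, u ≠ 2 * π * n) :
    ∃ n : ℤ, u - 2 * π * n ∈ Ioo 0 (2 * π) := by
  have hp := two_pi_pos
  refine ⟨⌊u / (2 * π)⌋, ?_, ?_⟩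
  · have h1 := Int.floor_le (u / (2 * π))
    rw [le_div_iff₀ hp] at h1
    have h2 := hu ⌊u / (2 * π)⌋
    rcases lt_or_eq_of_le h1 with h3 | h3
    · linarith
    · exact absurd (by linarith) h2
  · have h1 := Int.lt_floor_add_one (u / (2 * π))
    rw [div_lt_iff₀ hp] at h1
    linarith

theorem Function.Periodic.apply_sub_two_pi_mul {Γ : ℝ → ℝ} (h : Function.Periodic Γ (2 * π))
    (u : ℝ) (n : ℤ) : Γ (u - 2 * π * n) = Γ u := by
  rw [mul_comm]; exact h.sub_int_mul_eq n

/-- A monotone coupling whose curvature has constant sign is bounded on one side. -/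
theorem IsMonotoneCoupling.exists_bound {Γ : ℝ → ℝ} (h : IsMonotoneCoupling Γ)
    (hcurv : HasCurvatureOfConstantSign Γ) :
    ∃ C, (∀ u, -C ≤ Γ u) ∨ (∀ u, Γ u ≤ C) := by
  have hπ : π ∈ Ioo 0 (2 * π) := ⟨pi_pos, by linarith [pi_pos]⟩
  have hconv : Convex ℝ (Ioo (0 : ℝ) (2 * π)) := convex_Ioo _ _
  have hcont : ContinuousOn Γ (Ioo 0 (2 * π)) := fun x hx =>
    (h.differentiableAt x hx).continuousAt.continuousWithinAt
  have hdiff : DifferentiableOn ℝ Γ (interior (Ioo 0 (2 * π))) := by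
    rw [interior_Ioo]
    exact fun x hx => (h.differentiableAt x hx).differentiableWithinAt
  have hdiff' : DifferentiableOn ℝ (deriv Γ) (interior (Ioo 0 (2 * π))) := by
    rw [interior_Ioo]
    exact fun x hx => (hcurv.differentiableAt_deriv x hx).differentiableWithinAt
  set d := deriv Γ π
  have hbd : ∀ x ∈ Ioo 0 (2 * π), |d * (x - π)| ≤ |d| * π := fun x hx => by
    rw [abs_mul]
    exact mul_le_mul_of_nonneg_left (abs_le.2 ⟨by linarith [hx.1], by linarith [hx.2]⟩)
      (abs_nonneg _)
  refine ⟨|Γ 0| + |Γ π| + |d| * π, ?_⟩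
  have hreduce : ∀ P : ℝ → Prop, P (Γ 0) → (∀ x ∈ Ioo 0 (2 * π), P (Γ x)) → ∀ u, P (Γ u) := by
    intro P h0 hI u
    by_cases hu : ∀ n : ℤ, u ≠ 2 * π * n
    · obtain ⟨n, hn⟩ := exists_mem_Ioo_sub_two_pi_mul u hu
      rw [← h.periodic.apply_sub_two_pi_mul u n]
      exact hI _ hn
    · push Not at hu
      obtain ⟨n, hn⟩ := hu
      rw [← h.periodic.apply_sub_two_pi_mul u n, hn, sub_self]
      exact h0
  have hdp : 0 ≤ |d| * π := mul_nonneg (abs_nonneg _) pi_pos.le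
  rcases hcurv.curvature_sign with h1 | h1
  · have hcv : ConvexOn ℝ (Ioo 0 (2 * π)) Γ := convexOn_of_deriv2_nonneg hconv hcont hdiff hdiff'
      (by rw [interior_Ioo]; exact h1)
    refine Or.inl (hreduce (fun y => -(|Γ 0| + |Γ π| + |d| * π) ≤ y) ?_ fun x hx => ?_)
    · linarith [neg_abs_le (Γ 0), abs_nonneg (Γ π)]
    -- A convex function lies above its tangent at `π`, and that line is bounded on the interval.
    · have ht : Γ π + d * (x - π) ≤ Γ x := by
        rcases lt_trichotomy x π with hlt | rfl | hlt
        · have := hcv.slope_le_deriv hx hπ hlt (h.differentiableAt π hπ)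
          rw [slope_def_field, div_le_iff₀ (by linarith)] at this
          linarith
        · simp
        · have := hcv.deriv_le_slope hπ hx hlt (h.differentiableAt π hπ)
          rw [slope_def_field, le_div_iff₀ (by linarith)] at this
          linarith
      linarith [neg_abs_le (Γ π), abs_nonneg (Γ 0), (abs_le.1 (hbd x hx)).1]
  · have hcv : ConcaveOn ℝ (Ioo 0 (2 * π)) Γ := concaveOn_of_deriv2_nonpos hconv hcont hdiff hdiff'
      (by rw [interior_Ioo]; exact h1)
    refine Or.inr (hreduce (fun y => y ≤ |Γ 0| + |Γ π| + |d| * π) ?_ fun x hx => ?_)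
    · linarith [le_abs_self (Γ 0), abs_nonneg (Γ π)]
    · have ht : Γ x ≤ Γ π + d * (x - π) := by
        rcases lt_trichotomy x π with hlt | rfl | hlt
        · have := hcv.deriv_le_slope hx hπ hlt (h.differentiableAt π hπ)
          rw [slope_def_field, le_div_iff₀ (by linarith)] at this
          linarith
        · simp
        · have := hcv.slope_le_deriv hπ hx hlt (h.differentiableAt π hπ)
          rw [slope_def_field, div_le_iff₀ (by linarith)] at this
          linarith
      linarith [le_abs_self (Γ π), abs_nonneg (Γ 0), (abs_le.1 (hbd x hx)).2]

theorem IsMonotoneCoupling.continuousOn {Γ : ℝ → ℝ} (h : IsMonotoneCoupling Γ) :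
    ContinuousOn Γ (Ioo 0 (2 * π)) := fun x hx =>
  (h.differentiableAt x hx).continuousAt.continuousWithinAt

theorem IsMonotoneCoupling.exists_lipschitzOnWith {Γ : ℝ → ℝ} (h : IsMonotoneCoupling Γ)
    (hcurv : HasCurvatureOfConstantSign Γ) {m : ℝ} (hm : 0 < m) :
    ∃ K : NNReal, LipschitzOnWith K Γ (Icc m (2 * π - m)) := by
  have hsub : Icc m (2 * π - m) ⊆ Ioo 0 (2 * π) := fun x hx =>
    ⟨hm.trans_le hx.1, by linarith [hx.2]⟩
  have hcont : ContinuousOn (deriv Γ) (Icc m (2 * π - m)) := fun x hx =>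
    (hcurv.differentiableAt_deriv x (hsub hx)).continuousAt.continuousWithinAt
  obtain ⟨C, hC⟩ := isCompact_Icc.exists_bound_of_continuousOn hcont
  refine ⟨C.toNNReal, (convex_Icc _ _).lipschitzOnWith_of_nnnorm_deriv_le
    (fun x hx => h.differentiableAt x (hsub hx)) fun x hx => ?_⟩
  rw [← NNReal.coe_le_coe, coe_nnnorm]
  exact (hC x hx).trans (le_coe_toNNReal C)

/-! ### Cells of configurations and comparison of velocities -/

theorem inPhase_iff {a b : ℝ} : InPhase a b ↔ ∃ n : ℤ, a - b = 2 * π * n :=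
  Real.Angle.angle_eq_iff_two_pi_dvd_sub

theorem InPhase.refl (a : ℝ) : InPhase a a := Eq.refl (a : Real.Angle)

theorem InPhase.symm {a b : ℝ} (h : InPhase a b) : InPhase b a := Eq.symm h

theorem InPhase.trans {a b c : ℝ} (h : InPhase a b) (h' : InPhase b c) : InPhase a c :=
  Eq.trans h h'

/-- The cell of a configuration: it records, for every pair of oscillators, the number of full
turns in the lifted phase difference. -/
noncomputable def cell {N : ℕ} (x : Fin N → ℝ) (i j : Fin N) : ℤ := ⌊(x i - x j) / (2 * π)⌋

section

variable {N : ℕ} {Γ : ℝ → ℝ} {ω : ℝ} {x y : Fin N → ℝ} {i j k : Fin N}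

theorem cell_eq_iff {n : ℤ} :
    cell x i j = n ↔ 2 * π * n ≤ x i - x j ∧ x i - x j < 2 * π * (n + 1) := by
  rw [cell, Int.floor_eq_iff, le_div_iff₀ two_pi_pos, div_lt_iff₀ two_pi_pos, mul_comm (n : ℝ),
    mul_comm ((n : ℝ) + 1)]

theorem cell_le (x : Fin N → ℝ) (i j : Fin N) : 2 * π * cell x i j ≤ x i - x j :=
  (cell_eq_iff.1 rfl).1

theorem lt_cell_add_one (x : Fin N → ℝ) (i j : Fin N) : x i - x j < 2 * π * (cell x i j + 1) :=
  (cell_eq_iff.1 rfl).2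

theorem inPhase_iff_sub_eq_cell : InPhase (x i) (x j) ↔ x i - x j = 2 * π * cell x i j := by
  rw [inPhase_iff]
  refine ⟨fun ⟨n, hn⟩ => ?_, fun h => ⟨_, h⟩⟩
  have : cell x i j = n := by
    rw [cell_eq_iff, hn]
    exact ⟨le_rfl, by linarith [two_pi_pos]⟩
  rw [this, hn]

/-- The floors of `u` and `-u` add up to `0` when `u` is an integer and to `-1` otherwise. Thus the
cell alone determines which oscillators are in phase. -/
theorem inPhase_iff_cell : InPhase (x i) (x j) ↔ cell x i j + cell x j i = 0 := by
  constructor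
  · intro h
    have h1 := inPhase_iff_sub_eq_cell.1 h
    have h2 := inPhase_iff_sub_eq_cell.1 h.symm
    have h3 : (2 * π) * ((cell x i j : ℝ) + cell x j i) = 0 := by linarith
    have h4 := (mul_eq_zero.1 h3).resolve_left two_pi_pos.ne'
    exact_mod_cast h4
  · intro h
    have h' : (cell x j i : ℝ) = -cell x i j := by
      have : (cell x i j : ℝ) + cell x j i = 0 := by exact_mod_cast h
      linarith
    rw [inPhase_iff_sub_eq_cell]
    have h1 := cell_le x i j
    have h2 := cell_le x j i
    rw [h'] at h2
    linarith

theorem inPhase_congr (h : cell x = cell y) : InPhase (x i) (x j) ↔ InPhase (y i) (y j) := by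
  rw [inPhase_iff_cell, inPhase_iff_cell, h]

theorem sub_cell_mem_Ioo (h : ¬ InPhase (x i) (x j)) :
    x i - x j - 2 * π * cell x i j ∈ Ioo 0 (2 * π) := by
  rw [inPhase_iff_sub_eq_cell] at h
  have h1 := cell_le x i j
  have h2 := lt_cell_add_one x i j
  refine ⟨?_, by linarith⟩
  rcases lt_or_eq_of_le h1 with h3 | h3
  · linarith
  · exact absurd h3.symm h

/-- Including the diagonal term makes the sum invariant under permutations and identical for all
members of a cluster. -/
theorem phaseVelocity_eq (Γ : ℝ → ℝ) (ω : ℝ) (x : Fin N → ℝ) (k : Fin N) :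
    phaseVelocity Γ ω x k = (ω - Γ 0) + ∑ j, Γ (x k - x j) := by
  rw [phaseVelocity, ← Finset.add_sum_erase _ _ (Finset.mem_univ k), sub_self]
  ring

theorem phaseVelocity_neg (Γ : ℝ → ℝ) (ω : ℝ) (x : Fin N → ℝ) (k : Fin N) :
    phaseVelocity (fun u => -Γ u) (-ω) x k = -phaseVelocity Γ ω x k := by
  rw [phaseVelocity_eq, phaseVelocity_eq, Finset.sum_neg_distrib]
  ring

theorem phaseVelocity_eq_of_inPhase (hp : Function.Periodic Γ (2 * π))
    (h : InPhase (x i) (x j)) : phaseVelocity Γ ω x i = phaseVelocity Γ ω x j := by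
  obtain ⟨n, hn⟩ := inPhase_iff.1 h
  rw [phaseVelocity_eq, phaseVelocity_eq]
  congr 1
  refine Finset.sum_congr rfl fun l _ => ?_
  rw [← hp.apply_sub_two_pi_mul (x i - x l) n]
  congr 1
  linarith

/-- Relabelling the oscillators and changing the representatives of the phases. -/
theorem phaseVelocity_relabel (hp : Function.Periodic Γ (2 * π)) (x : Fin N → ℝ)
    (σ : Equiv.Perm (Fin N)) (z : Fin N → ℤ) (k : Fin N) :
    phaseVelocity Γ ω (fun k => x (σ k) + 2 * π * z k) k = phaseVelocity Γ ω x (σ k) := by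
  rw [phaseVelocity_eq, phaseVelocity_eq, ← Equiv.sum_comp σ fun j => Γ (x (σ k) - x j)]
  congr 1
  refine Finset.sum_congr rfl fun l _ => ?_
  rw [← hp.apply_sub_two_pi_mul _ (z k - z l)]
  congr 1
  push_cast
  ring

theorem phaseVelocity_congr_sub (h : ∀ i j, x i - x j = y i - y j) (k : Fin N) :
    phaseVelocity Γ ω x k = phaseVelocity Γ ω y k := by
  simp only [phaseVelocity_eq, h]

/-- In a common cell, both differences are reduced to `(0, 2π)` by the same multiple of `2π`, where
`Γ` is monotone; an in-phase pair has the same difference in both configurations, so the jump of `Γ`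
is never felt. -/
theorem IsRepulsive.le_of_cell_eq {c : ℝ} (hΓ : IsRepulsive Γ c) (hc : cell x = cell y)
    (h : x i - x j ≤ y i - y j) : Γ (y i - y j) ≤ Γ (x i - x j) := by
  by_cases hin : InPhase (x i) (x j)
  · have hin' := (inPhase_congr hc).1 hin
    rw [inPhase_iff_sub_eq_cell] at hin hin'
    rw [hin, hin', hc]
  · have hin' := mt (inPhase_congr hc).2 hin
    have h1 := sub_cell_mem_Ioo hin
    have h2 := sub_cell_mem_Ioo hin'
    rw [← hc] at h2
    rw [← hΓ.periodic.apply_sub_two_pi_mul _ (cell x i j),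
      ← hΓ.periodic.apply_sub_two_pi_mul (x i - x j) (cell x i j)]
    exact hΓ.antitoneOn h1 h2 (by linarith)

theorem IsRepulsive.rate_of_cell_eq {c : ℝ} (hΓ : IsRepulsive Γ c) (hc : cell x = cell y)
    (h : x i - x j ≤ y i - y j) : c * ((y i - y j) - (x i - x j)) ≤
      (Γ (x i - x j) - Γ (y i - y j)) + (Γ (y j - y i) - Γ (x j - x i)) := by
  by_cases hin : InPhase (x i) (x j)
  · have hin' := (inPhase_congr hc).1 hin
    have hin2 := inPhase_iff_sub_eq_cell.1 hin.symm
    have hin2' := inPhase_iff_sub_eq_cell.1 hin'.symm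
    rw [inPhase_iff_sub_eq_cell] at hin hin'
    rw [hin, hin', hin2, hin2', hc]
    simp
  · have hin' := mt (inPhase_congr hc).2 hin
    have h1 := sub_cell_mem_Ioo hin
    have h2 := sub_cell_mem_Ioo hin'
    rw [← hc] at h2
    have h3 := hΓ.rate _ _ h1.1 (sub_le_sub_right h _) h2.2
    set n := cell x i j
    rw [hΓ.periodic.apply_sub_two_pi_mul, hΓ.periodic.apply_sub_two_pi_mul] at h3
    -- The reversed pair has winding number `-(n + 1)`, which turns the reversed difference into
    -- `2π` minus the reduced one.
    rw [← hΓ.periodic.apply_sub_two_pi_mul (y j - y i) (-(n + 1)),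
      ← hΓ.periodic.apply_sub_two_pi_mul (x j - x i) (-(n + 1))]
    have e1 : y j - y i - 2 * π * ((-(n + 1) : ℤ) : ℝ) = 2 * π - (y i - y j - 2 * π * n) := by
      push_cast; ring
    have e2 : x j - x i - 2 * π * ((-(n + 1) : ℤ) : ℝ) = 2 * π - (x i - x j - 2 * π * n) := by
      push_cast; ring
    rw [e1, e2]
    linarith

/-- Where the displacement `y - x` is the largest, the velocity of `y` is at most that of `x`. -/
theorem IsRepulsive.phaseVelocity_le {c : ℝ} (hΓ : IsRepulsive Γ c) (hc : cell x = cell y)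
    (h : ∀ j, y j - x j ≤ y i - x i) : phaseVelocity Γ ω y i ≤ phaseVelocity Γ ω x i := by
  rw [phaseVelocity_eq, phaseVelocity_eq]
  gcongr with j
  exact hΓ.le_of_cell_eq hc (by linarith [h j])

/-- The largest displacement, relative to the smallest one, contracts at rate `c`. -/
theorem IsRepulsive.phaseVelocity_sub_le {c : ℝ} (hΓ : IsRepulsive Γ c) (hc : cell x = cell y)
    (hi : ∀ k, y k - x k ≤ y i - x i) (hj : ∀ k, y j - x j ≤ y k - x k) :
    (phaseVelocity Γ ω y i - phaseVelocity Γ ω x i)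
      - (phaseVelocity Γ ω y j - phaseVelocity Γ ω x j) ≤ -c * ((y i - x i) - (y j - x j)) := by
  simp only [phaseVelocity_eq]
  have h1 : ∑ k, (Γ (y i - y k) - Γ (x i - x k)) ≤ Γ (y i - y j) - Γ (x i - x j) := by
    rw [← Finset.add_sum_erase _ _ (Finset.mem_univ j), add_le_iff_nonpos_right]
    exact Finset.sum_nonpos fun k _ =>
      sub_nonpos.2 (hΓ.le_of_cell_eq hc (by linarith [hi k]))
  have h2 : Γ (y j - y i) - Γ (x j - x i) ≤ ∑ k, (Γ (y j - y k) - Γ (x j - x k)) := by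
    rw [← Finset.add_sum_erase _ _ (Finset.mem_univ i), le_add_iff_nonneg_right]
    exact Finset.sum_nonneg fun k _ =>
      sub_nonneg.2 (hΓ.le_of_cell_eq hc.symm (by linarith [hj k]))
  have h3 := hΓ.rate_of_cell_eq hc (show x i - x j ≤ y i - y j by linarith [hi j])
  simp only [Finset.sum_sub_distrib] at h1 h2
  linarith

/-- Two phase-locked configurations in the same cell differ by a common rotation. -/
theorem IsRepulsive.sub_eq_of_phaseLocked {c : ℝ} (hΓ : IsRepulsive Γ c) (hc : cell x = cell y)
    (hx : ∀ i j, phaseVelocity Γ ω x i = phaseVelocity Γ ω x j)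
    (hy : ∀ i j, phaseVelocity Γ ω y i = phaseVelocity Γ ω y j) (i j : Fin N) :
    y i - x i = y j - x j := by
  have : Nonempty (Fin N) := ⟨i⟩
  obtain ⟨a, ha⟩ := Finite.exists_max fun k => y k - x k
  obtain ⟨b, hb⟩ := Finite.exists_min fun k => y k - x k
  have h := hΓ.phaseVelocity_sub_le (ω := ω) hc ha hb
  rw [hx a b, hy a b, sub_self] at h
  have h2 : (y a - x a) - (y b - x b) ≤ 0 := by nlinarith [hΓ.pos]
  linarith [ha i, ha j, hb i, hb j]

end

/-! ### Comparison of solutions inside a cell -/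

/-- `y` solves the phase dynamics on `[0, T]`, staying in the cell `c` in the interior. -/
structure IsCellSolution {N : ℕ} (Γ : ℝ → ℝ) (ω : ℝ) (c : Fin N → Fin N → ℤ) (y : ℝ → Fin N → ℝ)
    (T : ℝ) : Prop where
  continuousOn : ContinuousOn y (Icc 0 T)
  cell_eq : ∀ t ∈ Ioo 0 T, cell (y t) = c
  hasDerivAt : ∀ t ∈ Ioo 0 T, ∀ k, HasDerivAt (fun s => y s k) (phaseVelocity Γ ω (y t) k) t

namespace IsCellSolution

variable {N : ℕ} {Γ : ℝ → ℝ} {ω T r : ℝ} {c : Fin N → Fin N → ℤ} {x y : ℝ → Fin N → ℝ}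

theorem continuousOn_apply (h : IsCellSolution Γ ω c y T) (k : Fin N) :
    ContinuousOn (fun t => y t k) (Icc 0 T) :=
  (continuous_apply k).comp_continuousOn h.continuousOn

theorem mono (h : IsCellSolution Γ ω c y T) {T' : ℝ} (hT : T' ≤ T) : IsCellSolution Γ ω c y T' where
  continuousOn := h.continuousOn.mono (Icc_subset_Icc_right hT)
  cell_eq t ht := h.cell_eq t ⟨ht.1, ht.2.trans_le hT⟩
  hasDerivAt t ht := h.hasDerivAt t ⟨ht.1, ht.2.trans_le hT⟩

theorem shift (h : IsCellSolution Γ ω c y T) {a T' : ℝ} (ha : 0 ≤ a) (hT : T' + a ≤ T) :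
    IsCellSolution Γ ω c (fun t => y (t + a)) T' where
  continuousOn := h.continuousOn.comp (by fun_prop) fun t ht =>
    ⟨by linarith [ht.1], by linarith [ht.2]⟩
  cell_eq t ht := h.cell_eq _ ⟨by linarith [ht.1], by linarith [ht.2]⟩
  hasDerivAt t ht k :=
    (h.hasDerivAt (t + a) ⟨by linarith [ht.1], by linarith [ht.2]⟩ k).comp_add_const t a

theorem reverse (h : IsCellSolution Γ ω c y T) :
    IsCellSolution (fun u => -Γ u) (-ω) c (fun t => y (T - t)) T where
  continuousOn := h.continuousOn.comp (by fun_prop) fun t ht =>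
    ⟨by linarith [ht.2], by linarith [ht.1]⟩
  cell_eq t ht := h.cell_eq _ ⟨by linarith [ht.2], by linarith [ht.1]⟩
  hasDerivAt t ht k := by
    rw [phaseVelocity_neg]
    exact (h.hasDerivAt (T - t) ⟨by linarith [ht.2], by linarith [ht.1]⟩ k).comp_const_sub T t

/-- The maximum principle with rate `0`, applied to the displacement. -/
theorem sub_le (hΓ : IsRepulsive Γ r) (hx : IsCellSolution Γ ω c x T)
    (hy : IsCellSolution Γ ω c y T) {A : ℝ} (h0 : ∀ k, y 0 k - x 0 k ≤ A) :
    ∀ t ∈ Icc 0 T, ∀ k, y t k - x t k ≤ A := by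
  have := exp_mul_le_of_forall_isMax (K := Fin N) (w := fun t k => y t k - x t k)
    (w' := fun t k => phaseVelocity Γ ω (y t) k - phaseVelocity Γ ω (x t) k) (c := 0) (A := A)
    (fun k => (hy.continuousOn_apply k).sub (hx.continuousOn_apply k))
    (fun t ht k => (hy.hasDerivAt t ht k).sub (hx.hasDerivAt t ht k))
    (fun t ht k hk => by
      have := hΓ.phaseVelocity_le (ω := ω) ((hx.cell_eq t ht).trans (hy.cell_eq t ht).symm) hk
      simpa using this) h0
  simpa using this

theorem le_sub (hΓ : IsRepulsive Γ r) (hx : IsCellSolution Γ ω c x T)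
    (hy : IsCellSolution Γ ω c y T) {A : ℝ} (h0 : ∀ k, A ≤ y 0 k - x 0 k) :
    ∀ t ∈ Icc 0 T, ∀ k, A ≤ y t k - x t k := fun t ht k => by
  have := hy.sub_le hΓ hx (A := -A) (fun k => by linarith [h0 k]) t ht k
  linarith

/-- The maximum principle over ordered pairs: a pair maximizes the difference of displacements
exactly when its entries are a largest and a smallest displacement. -/
theorem exp_mul_sub_sub_le (hΓ : IsRepulsive Γ r) (hx : IsCellSolution Γ ω c x T)
    (hy : IsCellSolution Γ ω c y T) {A : ℝ}
    (h0 : ∀ i j, (y 0 i - x 0 i) - (y 0 j - x 0 j) ≤ A) :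
    ∀ t ∈ Icc 0 T, ∀ i j, exp (r * t) * ((y t i - x t i) - (y t j - x t j)) ≤ A := by
  have hc : ∀ k, ContinuousOn (fun t => y t k - x t k) (Icc 0 T) := fun k =>
    (hy.continuousOn_apply k).sub (hx.continuousOn_apply k)
  have hd : ∀ t ∈ Ioo 0 T, ∀ k, HasDerivAt (fun t => y t k - x t k)
      (phaseVelocity Γ ω (y t) k - phaseVelocity Γ ω (x t) k) t := fun t ht k =>
    (hy.hasDerivAt t ht k).sub (hx.hasDerivAt t ht k)
  have := exp_mul_le_of_forall_isMax (K := Fin N × Fin N)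
    (w := fun t p => (y t p.1 - x t p.1) - (y t p.2 - x t p.2))
    (w' := fun t p => (phaseVelocity Γ ω (y t) p.1 - phaseVelocity Γ ω (x t) p.1)
      - (phaseVelocity Γ ω (y t) p.2 - phaseVelocity Γ ω (x t) p.2)) (c := r) (A := A)
    (fun p => (hc p.1).sub (hc p.2)) (fun t ht p => (hd t ht p.1).sub (hd t ht p.2))
    (fun t ht p hp => hΓ.phaseVelocity_sub_le
      ((hx.cell_eq t ht).trans (hy.cell_eq t ht).symm)
      (fun k => by have := hp (k, p.2); simp only at this; linarith)
      (fun k => by have := hp (p.1, k); simp only at this; linarith))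
    (fun p => h0 p.1 p.2)
  exact fun t ht i j => this t ht (i, j)

end IsCellSolution

/-! ### Walls of a cell and clusters -/

section

variable {N : ℕ} {Γ : ℝ → ℝ} {ω : ℝ} {x y : Fin N → ℝ} {i j k : Fin N}

theorem cell_swap_of_not_inPhase (h : ¬ InPhase (x i) (x j)) : cell x j i = -cell x i j - 1 := by
  have h1 := sub_cell_mem_Ioo h
  rw [cell_eq_iff]
  push_cast
  constructor <;> linarith [h1.1, h1.2]

/-- The lower walls for `(i, j)` and `(j, i)` together put `y` in the closed cell; being on the
upper wall would put a new pair in phase. -/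
theorem cell_eq_of_forall_le (hle : ∀ i j, 2 * π * cell x i j ≤ y i - y j)
    (h : ∀ i j, InPhase (y i) (y j) → InPhase (x i) (x j)) : cell y = cell x := by
  ext i j
  rw [cell_eq_iff]
  refine ⟨hle i j, ?_⟩
  have h1 := hle i j
  have h2 := hle j i
  by_cases hin : InPhase (x i) (x j)
  · have h3 := inPhase_iff_cell.1 hin
    have h4 : (cell x j i : ℝ) = -cell x i j := by
      have : (cell x i j : ℝ) + cell x j i = 0 := by exact_mod_cast h3
      linarith
    rw [h4] at h2
    linarith [two_pi_pos]
  · rw [cell_swap_of_not_inPhase hin] at h2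
    push_cast at h2
    refine lt_of_le_of_ne (by linarith) fun heq => hin (h i j (inPhase_iff.2 ⟨cell x i j + 1, ?_⟩))
    push_cast
    exact heq

/-- In a fixed cell the in-phase terms are constantly `Γ 0`, while the reduced arguments of all
other terms stay in `(0, 2π)`, away from the jump. -/
theorem continuousOn_phaseVelocity (hp : Function.Periodic Γ (2 * π))
    (hc : ContinuousOn Γ (Ioo 0 (2 * π))) {y : ℝ → Fin N → ℝ} {s : Set ℝ}
    (hy : ContinuousOn y s) {c : Fin N → Fin N → ℤ} (hcell : ∀ t ∈ s, cell (y t) = c) (k : Fin N) :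
    ContinuousOn (fun t => phaseVelocity Γ ω (y t) k) s := by
  simp only [phaseVelocity_eq]
  refine continuousOn_const.add (continuousOn_finsetSum _ fun j _ => ?_)
  have hy' : ∀ k, ContinuousOn (fun t => y t k) s := fun k =>
    (continuous_apply k).comp_continuousOn hy
  by_cases h : c k j + c j k = 0
  · refine (continuousOn_const (c := Γ 0)).congr fun t ht => ?_
    rw [← hcell t ht, ← inPhase_iff_cell, inPhase_iff_sub_eq_cell] at h
    simp only
    rw [← hp.apply_sub_two_pi_mul _ (cell (y t) k j), h, sub_self]
  · have : ContinuousOn (fun t => Γ (y t k - y t j - 2 * π * c k j)) s := by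
      refine hc.comp (((hy' k).sub (hy' j)).sub continuousOn_const) fun t ht => ?_
      rw [← hcell t ht] at h ⊢
      exact sub_cell_mem_Ioo (mt inPhase_iff_cell.1 h)
    refine this.congr fun t _ => ?_
    simp only [hp.apply_sub_two_pi_mul]

/-- The number of distinct phases on the circle. -/
noncomputable def numClusters (x : Fin N → ℝ) : ℕ :=
  (Set.range fun i => (x i : Real.Angle)).ncard

theorem numClusters_le (x : Fin N → ℝ) : numClusters x ≤ N := by
  rw [numClusters, ← Set.image_univ]
  refine (Set.ncard_image_le).trans ?_
  simp

theorem one_lt_numClusters (h : ¬ InPhase (x i) (x j)) : 1 < numClusters x :=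
  (Set.one_lt_ncard_iff (Set.finite_range _)).2 ⟨_, _, ⟨i, rfl⟩, ⟨j, rfl⟩, h⟩

/-- The phases of `y` are the image of the phases of `x` under a map that is well defined because
clusters persist; equal cardinalities would make that map injective, contradicting the merger of `i`
and `j`. -/
theorem numClusters_lt (h : ∀ i j, InPhase (x i) (x j) → InPhase (y i) (y j))
    (hx : ¬ InPhase (x i) (x j)) (hy : InPhase (y i) (y j)) : numClusters y < numClusters x := by
  classical
  let f : Real.Angle → Fin N := fun a => if h : ∃ k, (x k : Real.Angle) = a then h.choose else i
  have hf : ∀ k, InPhase (x (f (x k))) (x k) := fun k => by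
    have h : ∃ l, (x l : Real.Angle) = (x k : Real.Angle) := ⟨k, rfl⟩
    have h' : f (x k) = h.choose := dif_pos h
    rw [h']
    exact h.choose_spec
  have himg : (fun a => (y (f a) : Real.Angle)) '' (Set.range fun i => (x i : Real.Angle))
      = Set.range fun i => (y i : Real.Angle) := by
    rw [← Set.range_comp]
    exact congrArg Set.range (funext fun k => h _ _ (hf k))
  rw [numClusters, numClusters, ← himg]
  refine lt_of_le_of_ne (Set.ncard_image_le (Set.finite_range _)) fun heq => hx ?_
  have hinj := Set.injOn_of_ncard_image_eq heq (Set.finite_range _)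
  exact hinj ⟨i, rfl⟩ ⟨j, rfl⟩ ((h _ _ (hf i)).trans (hy.trans (h _ _ (hf j)).symm))

end

/-! ### Solutions of the network until their first collision -/

namespace IsNetworkSolution

variable {N : ℕ} {Γ : ℝ → ℝ} {ω : ℝ} {x : Fin N → ℝ} {θ : ℝ → Fin N → ℝ}

theorem apply_zero (h : IsNetworkSolution Γ ω x θ) : θ 0 = x := by
  ext k
  simp [h.eq_integral 0 le_rfl k]

theorem continuousOn (h : IsNetworkSolution Γ ω x θ) : ContinuousOn θ (Ici 0) := by
  rw [continuousOn_pi]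
  intro k t ht
  have ht1 : (0 : ℝ) ≤ t + 1 := by linarith [mem_Ici.1 ht]
  have h1 := intervalIntegral.continuousOn_primitive_interval'
    (h.intervalIntegrable (t + 1) ht1 k) left_mem_uIcc
  rw [uIcc_of_le ht1] at h1
  have h2 : ContinuousOn (fun s => θ s k) (Icc 0 (t + 1)) :=
    (continuousOn_const.add h1).congr fun s hs => h.eq_integral s hs.1 k
  refine (h2 t ⟨ht, by linarith⟩).mono_of_mem_nhdsWithin ?_
  exact mem_nhdsWithin.2 ⟨Iio (t + 1), isOpen_Iio, by simp, fun s hs => ⟨hs.2, hs.1.le⟩⟩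

theorem continuousOn_sub (h : IsNetworkSolution Γ ω x θ) (i j : Fin N) :
    ContinuousOn (fun t => θ t i - θ t j) (Ici 0) :=
  ((continuous_apply i).comp_continuousOn h.continuousOn).sub
    ((continuous_apply j).comp_continuousOn h.continuousOn)

theorem shift (h : IsNetworkSolution Γ ω x θ) {s : ℝ} (hs : 0 ≤ s) :
    IsNetworkSolution Γ ω (θ s) (fun t => θ (t + s)) := by
  have hint : ∀ t : ℝ, 0 ≤ t → ∀ k,
      IntervalIntegrable (fun u => phaseVelocity Γ ω (θ u) k) volume s (t + s) := fun t ht k =>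
    (h.intervalIntegrable s hs k).symm.trans (h.intervalIntegrable (t + s) (by linarith) k)
  constructor
  · intro t ht k
    simpa using (hint t ht k).comp_add_right s
  · intro t ht k
    rw [intervalIntegral.integral_comp_add_right (fun u => phaseVelocity Γ ω (θ u) k) s, zero_add,
      h.eq_integral (t + s) (by linarith), h.eq_integral s hs, add_assoc,
      intervalIntegral.integral_add_adjacent_intervals (h.intervalIntegrable s hs k) (hint t ht k)]
  · intro a b ha hab i j hin
    exact h.inPhase_forever (a + s) (b + s) (by linarith) (by linarith) i j hin

/-- Phase differences never leave the closure of the initial cell. -/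
theorem cell_le (h : IsNetworkSolution Γ ω x θ) {t : ℝ} (ht : 0 ≤ t) (i j : Fin N) :
    2 * π * cell x i j ≤ θ t i - θ t j := by
  set n := cell x i j
  set u : ℝ → ℝ := fun t => θ t i - θ t j with hu
  by_contra! hlt
  have hcont : ContinuousOn u (Ici 0) := h.continuousOn_sub i j
  have hu0 : 2 * π * n ≤ u 0 := by
    simp only [hu, h.apply_zero]; exact _root_.cell_le x i j
  obtain ⟨s, hs, hsn⟩ := intermediate_value_Icc' ht (hcont.mono Icc_subset_Ici_self)
    (show 2 * π * (n : ℝ) ∈ Icc (u t) (u 0) from ⟨hlt.le, hu0⟩)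
  have hsin : InPhase (θ s i) (θ s j) := inPhase_iff.2 ⟨n, hsn⟩
  -- After touching the wall at time `s`, the difference would cross a value `v` in `[2πn - π,
  -- 2πn)`. No multiple of `2π` lies there, so the pair would have fallen out of phase.
  set v := max ((u t + 2 * π * n) / 2) (2 * π * n - π) with hv
  have hv1 : u t < v := lt_max_of_lt_left (by linarith [show u t < 2 * π * n from hlt])
  have hv2 : v < 2 * π * n := max_lt (by linarith [show u t < 2 * π * n from hlt])
    (by linarith [pi_pos])
  have hv3 : 2 * π * n - π ≤ v := le_max_right _ _
  obtain ⟨s', hs', hs'v⟩ := intermediate_value_Icc' hs.2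
    (hcont.mono fun a ha => hs.1.trans ha.1)
    (show v ∈ Icc (u t) (u s) from ⟨hv1.le, by rw [hsn]; exact hv2.le⟩)
  obtain ⟨m, hm⟩ := inPhase_iff.1 (h.inPhase_forever s s' hs.1 hs'.1 i j hsin)
  have hm' : v = 2 * π * m := hs'v.symm.trans hm
  rw [hm'] at hv2 hv3
  have h1 : (m : ℝ) < n := lt_of_mul_lt_mul_left hv2 two_pi_pos.le
  have h2 : (m : ℝ) ≤ n - 1 := by
    have : m ≤ n - 1 := by have := Int.cast_lt.1 h1; lia
    exact_mod_cast this
  have h3 := mul_le_mul_of_nonneg_left h2 two_pi_pos.le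
  linarith [pi_pos]

theorem cell_eq (h : IsNetworkSolution Γ ω x θ) {t : ℝ} (ht : 0 ≤ t)
    (hin : ∀ i j, InPhase (θ t i) (θ t j) → InPhase (x i) (x j)) : cell (θ t) = cell x :=
  cell_eq_of_forall_le (h.cell_le ht) hin

theorem isClosed_inPhase (h : IsNetworkSolution Γ ω x θ) (i j : Fin N) :
    IsClosed {t | 0 ≤ t ∧ InPhase (θ t i) (θ t j)} := by
  have h1 : ContinuousOn (fun t => ((θ t i - θ t j : ℝ) : Real.Angle)) (Ici 0) :=
    Real.Angle.continuous_coe.comp_continuousOn (h.continuousOn_sub i j)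
  have h2 := h1.preimage_isClosed_of_isClosed isClosed_Ici (isClosed_singleton (x := 0))
  convert h2 using 1
  ext t
  simp [InPhase, sub_eq_zero]

/-- Either the solution stays in its cell forever, or there is a first time at which some further
pair of oscillators gets in phase. -/
theorem forall_cell_eq_or_exists (h : IsNetworkSolution Γ ω x θ) :
    (∀ t, 0 ≤ t → cell (θ t) = cell x) ∨
      ∃ τ, 0 < τ ∧ (∀ t, 0 ≤ t → t < τ → cell (θ t) = cell x) ∧
        ∃ i j, ¬ InPhase (x i) (x j) ∧ InPhase (θ τ i) (θ τ j) := by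
  set S : Set ℝ := ⋃ p : {p : Fin N × Fin N // ¬ InPhase (x p.1) (x p.2)},
    {t | 0 ≤ t ∧ InPhase (θ t p.1.1) (θ t p.1.2)} with hS
  have hmem : ∀ t, t ∈ S ↔ 0 ≤ t ∧ ∃ i j, ¬ InPhase (x i) (x j) ∧ InPhase (θ t i) (θ t j) := by
    intro t
    simp only [hS, mem_iUnion, mem_ofPred_eq, Subtype.exists, Prod.exists]
    grind
  have hclosed : IsClosed S := isClosed_iUnion_of_finite fun p => h.isClosed_inPhase _ _
  have hout : ∀ t, 0 ≤ t → t ∉ S → cell (θ t) = cell x := fun t ht hts =>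
    h.cell_eq ht fun i j hin => by
      by_contra hx
      exact hts ((hmem t).2 ⟨ht, i, j, hx, hin⟩)
  have hbdd : BddBelow S := ⟨0, fun t ht => ((hmem t).1 ht).1⟩
  rcases S.eq_empty_or_nonempty with hemp | hne
  · exact Or.inl fun t ht => hout t ht (by simp [hemp])
  · right
    obtain ⟨h0, i, j, hij, hin⟩ := (hmem _).1 (hclosed.csInf_mem hne hbdd)
    refine ⟨sInf S, lt_of_le_of_ne h0 fun heq => ?_, fun t ht htS => hout t ht
      fun hts => absurd (csInf_le hbdd hts) (not_le.2 htS), i, j, hij, hin⟩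
    rw [← heq, h.apply_zero] at hin
    exact hij hin

/-- While the cell is constant the integrand is continuous, so the integral equation can be
differentiated. -/
theorem isCellSolution (h : IsNetworkSolution Γ ω x θ) (hp : Function.Periodic Γ (2 * π))
    (hc : ContinuousOn Γ (Ioo 0 (2 * π))) {T : ℝ} {c : Fin N → Fin N → ℤ}
    (hcell : ∀ t ∈ Ioo 0 T, cell (θ t) = c) : IsCellSolution Γ ω c θ T where
  continuousOn := h.continuousOn.mono Icc_subset_Ici_self
  cell_eq := hcell
  hasDerivAt t ht k := by
    have hv : ContinuousOn (fun s => phaseVelocity Γ ω (θ s) k) (Ioo 0 T) :=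
      continuousOn_phaseVelocity hp hc (h.continuousOn.mono fun s hs => hs.1.le) hcell k
    have hI := intervalIntegral.integral_hasDerivAt_right (h.intervalIntegrable t ht.1.le k)
      (hv.stronglyMeasurableAtFilter isOpen_Ioo t ht) (hv.continuousAt (isOpen_Ioo.mem_nhds ht))
    refine (hI.const_add (x k)).congr_of_eventuallyEq ?_
    filter_upwards [isOpen_Ioo.mem_nhds ht] with s hs using h.eq_integral s hs.1.le k

theorem relabel (h : IsNetworkSolution Γ ω x θ) (hp : Function.Periodic Γ (2 * π))
    (σ : Equiv.Perm (Fin N)) (z : Fin N → ℤ) :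
    IsNetworkSolution Γ ω (fun k => x (σ k) + 2 * π * z k)
      (fun t k => θ t (σ k) + 2 * π * z k) := by
  constructor
  · intro t ht k
    simp only [phaseVelocity_relabel hp]
    exact h.intervalIntegrable t ht (σ k)
  · intro t ht k
    simp only [phaseVelocity_relabel hp]
    rw [h.eq_integral t ht (σ k)]
    ring
  · intro s t hs hst i j hin
    have key : ∀ t, InPhase (θ t (σ i) + 2 * π * z i) (θ t (σ j) + 2 * π * z j) ↔
        InPhase (θ t (σ i)) (θ t (σ j)) := by
      intro t
      rw [inPhase_iff, inPhase_iff]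
      constructor
      · rintro ⟨n, hn⟩
        exact ⟨n - z i + z j, by push_cast; linarith⟩
      · rintro ⟨n, hn⟩
        exact ⟨n + z i - z j, by push_cast; linarith⟩
    rw [key] at hin ⊢
    exact h.inPhase_forever s t hs hst _ _ hin

end IsNetworkSolution

/-! ### From solutions in a cell to solutions of the network -/

namespace IsCellSolution

variable {N : ℕ} {Γ : ℝ → ℝ} {ω T : ℝ} {c : Fin N → Fin N → ℤ} {y : ℝ → Fin N → ℝ}

theorem cell_le (h : IsCellSolution Γ ω c y T) (hT : 0 < T) (i j : Fin N) :
    ∀ t ∈ Icc 0 T, 2 * π * c i j ≤ y t i - y t j := by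
  have hcl : IsClosed {t | t ∈ Icc 0 T ∧ 2 * π * c i j ≤ y t i - y t j} :=
    ((h.continuousOn_apply i).sub (h.continuousOn_apply j)).preimage_isClosed_of_isClosed
      isClosed_Icc isClosed_Ici
  have hsub : Ioo 0 T ⊆ {t | t ∈ Icc 0 T ∧ 2 * π * c i j ≤ y t i - y t j} := fun t ht =>
    ⟨Ioo_subset_Icc_self ht, by rw [← h.cell_eq t ht]; exact _root_.cell_le _ _ _⟩
  have := hcl.closure_subset_iff.2 hsub
  rw [closure_Ioo hT.ne] at this
  exact fun t ht => (this ht).2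

/-- The two opposite lower walls pin the difference to `2π * c i j`, also at the endpoints, where
the cell itself may change. -/
theorem inPhase (h : IsCellSolution Γ ω c y T) (hT : 0 < T) {i j : Fin N}
    (hij : c i j + c j i = 0) {t : ℝ} (ht : t ∈ Icc 0 T) : InPhase (y t i) (y t j) := by
  refine inPhase_iff.2 ⟨c i j, ?_⟩
  have h1 := h.cell_le hT i j t ht
  have h2 := h.cell_le hT j i t ht
  have h3 : (c j i : ℝ) = -c i j := by
    have : (c i j : ℝ) + c j i = 0 := by exact_mod_cast hij
    linarith
  rw [h3] at h2
  linarith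

theorem eq_integral (h : IsCellSolution Γ ω c y T) (hT : 0 ≤ T) (k : Fin N)
    (hint : IntervalIntegrable (fun t => phaseVelocity Γ ω (y t) k) volume 0 T) :
    y T k = y 0 k + ∫ t in (0 : ℝ)..T, phaseVelocity Γ ω (y t) k := by
  rw [intervalIntegral.integral_eq_sub_of_hasDerivAt_of_le hT (h.continuousOn_apply k)
    (fun t ht => h.hasDerivAt t ht k) hint]
  ring

theorem intervalIntegrable (h : IsCellSolution Γ ω c y T) (hT : 0 ≤ T)
    (hp : Function.Periodic Γ (2 * π)) (hc : ContinuousOn Γ (Ioo 0 (2 * π)))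
    (h0 : cell (y 0) = c) (h1 : cell (y T) = c) (k : Fin N) :
    IntervalIntegrable (fun t => phaseVelocity Γ ω (y t) k) volume 0 T := by
  refine ContinuousOn.intervalIntegrable ?_
  rw [uIcc_of_le hT]
  refine continuousOn_phaseVelocity hp hc h.continuousOn (c := c) (fun t ht => ?_) k
  rcases eq_or_lt_of_le ht.1 with rfl | h2
  · exact h0
  rcases eq_or_lt_of_le ht.2 with rfl | h3
  · exact h1
  exact h.cell_eq t ⟨h2, h3⟩

theorem isNetworkSolution (hp : Function.Periodic Γ (2 * π))
    (hc : ContinuousOn Γ (Ioo 0 (2 * π)))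
    (h : ∀ T, IsCellSolution Γ ω (cell (y 0)) y T) : IsNetworkSolution Γ ω (y 0) y := by
  have hcell : ∀ t, 0 ≤ t → cell (y t) = cell (y 0) := fun t ht => by
    rcases eq_or_lt_of_le ht with rfl | ht
    · rfl
    · exact (h (t + 1)).cell_eq t ⟨ht, by linarith⟩
  have hint := fun t ht k => (h t).intervalIntegrable ht hp hc rfl (hcell t ht) k
  refine ⟨hint, fun t ht k => (h t).eq_integral ht k (hint t ht k), ?_⟩
  intro s t hs hst i j hin
  exact (inPhase_congr ((hcell s hs).trans (hcell t (hs.trans hst)).symm)).1 hin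

/-- A solution in a cell, up to its exit time, followed by a solution of the network. -/
theorem exists_isNetworkSolution (h : IsCellSolution Γ ω (cell (y 0)) y T) (hT : 0 < T)
    (hint : ∀ k, IntervalIntegrable (fun t => phaseVelocity Γ ω (y t) k) volume 0 T)
    {θ : ℝ → Fin N → ℝ} (hθ : IsNetworkSolution Γ ω (y T) θ) :
    ∃ θ, IsNetworkSolution Γ ω (y 0) θ := by
  set u : ℝ → Fin N → ℝ := fun t => if t ≤ T then y t else θ (t - T) with hu
  have hle : ∀ t, t ≤ T → u t = y t := fun t ht => if_pos ht
  have hge : ∀ t, T ≤ t → u t = θ (t - T) := fun t ht => by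
    rcases eq_or_lt_of_le ht with rfl | ht
    · rw [hle _ le_rfl, sub_self, hθ.apply_zero]
    · exact if_neg (not_le.2 ht)
  have hint1 : ∀ t ∈ Icc 0 T, ∀ k,
      IntervalIntegrable (fun s => phaseVelocity Γ ω (u s) k) volume 0 t := by
    intro t ht k
    have : IntervalIntegrable (fun s => phaseVelocity Γ ω (y s) k) volume 0 t :=
      (hint k).mono_set (by rw [uIcc_of_le ht.1, uIcc_of_le hT.le]; exact Icc_subset_Icc_right ht.2)
    refine this.congr fun s hs => ?_
    rw [uIoc_of_le ht.1] at hs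
    simp only [hle s (hs.2.trans ht.2)]
  have hint2 : ∀ t, T ≤ t → ∀ k,
      IntervalIntegrable (fun s => phaseVelocity Γ ω (u s) k) volume T t := by
    intro t ht k
    have := (hθ.intervalIntegrable (t - T) (by linarith) k).comp_sub_right T
    simp only [zero_add, sub_add_cancel] at this
    refine this.congr fun s hs => ?_
    rw [uIoc_of_le ht] at hs
    simp only [hge s hs.1.le]
  have hval1 : ∀ t ∈ Icc 0 T, ∀ k, u t k = y 0 k + ∫ s in (0 : ℝ)..t, phaseVelocity Γ ω (u s) k := by
    intro t ht k
    rw [hle t ht.2, (h.mono ht.2).eq_integral ht.1 k]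
    · congr 1
      refine intervalIntegral.integral_congr fun s hs => ?_
      rw [uIcc_of_le ht.1] at hs
      simp only [hle s (hs.2.trans ht.2)]
    · exact (hint k).mono_set
        (by rw [uIcc_of_le ht.1, uIcc_of_le hT.le]; exact Icc_subset_Icc_right ht.2)
  have hTm : T ∈ Icc 0 T := ⟨hT.le, le_rfl⟩
  refine ⟨u, ?_, ?_, ?_⟩
  · intro t ht k
    rcases le_total t T with htT | htT
    · exact hint1 t ⟨ht, htT⟩ k
    · exact (hint1 T hTm k).trans (hint2 t htT k)
  · intro t ht k
    rcases le_total t T with htT | htT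
    · exact hval1 t ⟨ht, htT⟩ k
    · rw [← intervalIntegral.integral_add_adjacent_intervals (hint1 T hTm k) (hint2 t htT k),
        ← add_assoc, ← hval1 T hTm k, hge t htT, hle T le_rfl,
        hθ.eq_integral (t - T) (by linarith) k]
      congr 1
      have h1 := intervalIntegral.integral_comp_sub_right (a := T) (b := t)
        (fun s => phaseVelocity Γ ω (θ s) k) T
      rw [sub_self] at h1
      rw [← h1]
      refine intervalIntegral.integral_congr fun s hs => ?_
      rw [uIcc_of_le htT] at hs
      simp only [hge s hs.1]
  · intro s t hs hst i j hin
    -- Before `T` the cell is constant, so a pair in phase then is in phase already in the cell of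
    -- `y 0`, hence up to and including `T`; from there on `θ` keeps it in phase.
    have hkey : s ≤ T → ∀ t ∈ Icc s T, InPhase (u t i) (u t j) := by
      intro hsT t ht
      rcases eq_or_lt_of_le hsT with rfl | hsT'
      · rwa [le_antisymm ht.2 ht.1]
      have hcs : cell (y s) = cell (y 0) := by
        rcases eq_or_lt_of_le hs with rfl | hs
        · rfl
        · exact h.cell_eq s ⟨hs, hsT'⟩
      rw [hle s hsT, inPhase_iff_cell, hcs] at hin
      rw [hle t ht.2]
      exact h.inPhase hT hin ⟨hs.trans ht.1, ht.2⟩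
    rcases le_total t T with htT | htT
    · exact hkey (hst.trans htT) t ⟨hst, htT⟩
    rcases le_total s T with hsT | hsT
    · have := hkey hsT T ⟨hsT, le_rfl⟩
      rw [hge T le_rfl, sub_self] at this
      rw [hge t htT]
      exact hθ.inPhase_forever 0 (t - T) le_rfl (by linarith) i j this
    · rw [hge s hsT] at hin
      rw [hge t htT]
      exact hθ.inPhase_forever (s - T) (t - T) (by linarith) (by linarith) i j hin

end IsCellSolution

/-! ### Maximal solutions inside a cell -/

/-- Maximal integral curves of a vector field `V` that on each set `C m` of an exhaustion coincides
with a bounded Lipschitz field `F m`: the curve exists forever or leaves every `C m`. Openness of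
the exhaustion is only needed relative to a set `I` which contains the integral curves of `F m`. -/
theorem exists_maximal_integralCurve {E : Type*} [NormedAddCommGroup E] [NormedSpace ℝ E]
    [CompleteSpace E] {C : ℝ → Set E} {V : E → E} {F : ℝ → E → E} {I : Set E} {x : E} {m₀ : ℝ}
    (hF : ∀ m, 0 < m → m ≤ m₀ → ∃ K L : NNReal, LipschitzWith K (F m) ∧ ∀ y, ‖F m y‖ ≤ L)
    (hFV : ∀ m, 0 < m → m ≤ m₀ → ∀ y ∈ C m, F m y = V y)
    (hanti : ∀ m m', m' ≤ m → C m ⊆ C m') (hclosed : ∀ m, IsClosed (C m))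
    (hx : ∃ m, 0 < m ∧ m ≤ m₀ ∧ x ∈ C m)
    (hI : ∀ m, 0 < m → m ≤ m₀ → ∀ z : ℝ → E, z 0 = x → (∀ t, HasDerivAt z (F m (z t)) t) →
      ∀ t, z t ∈ I)
    (hopen : ∀ m m', m' < m → ∀ y ∈ C m, ∀ᶠ z in 𝓝[I] y, z ∈ C m') :
    ∃ y : ℝ → E, y 0 = x ∧ ∃ S : Set ℝ,
      (∀ T ∈ S, ContinuousOn y (Icc 0 T) ∧ (∀ t ∈ Icc 0 T, ∃ m, 0 < m ∧ y t ∈ C m) ∧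
        ∀ t ∈ Ioo 0 T, HasDerivAt y (V (y t)) t) ∧
      ((∀ T, 0 ≤ T → T ∈ S) ∨ ∃ τ, 0 < τ ∧ (∀ T, 0 ≤ T → T < τ → T ∈ S) ∧
        ∀ m, 0 < m → m ≤ m₀ → ∃ t ∈ Ico 0 τ, y t ∉ C m) := by
  have hY : ∀ m : {m : ℝ // 0 < m ∧ m ≤ m₀}, ∃ z : ℝ → E, z 0 = x ∧
      ∀ t, HasDerivAt z (F m (z t)) t := fun m => by
    obtain ⟨K, L, hK, hL⟩ := hF m m.2.1 m.2.2
    exact hK.exists_forall_hasDerivAt hL x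
  choose Y hY0 hYd using hY
  have hYc : ∀ m, Continuous (Y m) := fun m =>
    continuous_iff_continuousAt.2 fun t => (hYd m t).continuousAt
  have agree : ∀ (m m' : {m : ℝ // 0 < m ∧ m ≤ m₀}) (T : ℝ), (∀ t ∈ Icc 0 T, Y m t ∈ C m ∧ Y m t ∈ C m') →
      EqOn (Y m) (Y m') (Icc 0 T) := by
    intro m m' T h
    obtain ⟨K, L, hK, -⟩ := hF m' m'.2.1 m'.2.2
    refine ODE_solution_unique (v := fun _ => F m') (fun _ => hK) (hYc m).continuousOn
      (fun t ht => ?_) (hYc m').continuousOn (fun t _ => (hYd m' t).hasDerivWithinAt)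
      (by rw [hY0, hY0])
    have h1 := h t (Ico_subset_Icc_self ht)
    rw [hFV m' m'.2.1 m'.2.2 _ h1.2, ← hFV m m.2.1 m.2.2 _ h1.1]
    exact (hYd m t).hasDerivWithinAt
  have agree' : ∀ (m m' : {m : ℝ // 0 < m ∧ m ≤ m₀}) (T : ℝ), (∀ t ∈ Icc 0 T, Y m t ∈ C m) → (∀ t ∈ Icc 0 T, Y m' t ∈ C m') →
      EqOn (Y m) (Y m') (Icc 0 T) := by
    intro m m' T h h'
    rcases le_total (m : ℝ) m' with hle | hle
    · exact (agree m' m T fun t ht => ⟨h' t ht, hanti _ _ hle (h' t ht)⟩).symm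
    · exact agree m m' T fun t ht => ⟨h t ht, hanti _ _ hle (h t ht)⟩
  classical
  set S : Set ℝ := {T | 0 ≤ T ∧ ∃ m : {m : ℝ // 0 < m ∧ m ≤ m₀},
    ∀ t ∈ Icc 0 T, Y m t ∈ C m} with hS
  have hdown : ∀ T ∈ S, ∀ T', 0 ≤ T' → T' ≤ T → T' ∈ S := fun T hT T' h0 hle =>
    ⟨h0, hT.2.imp fun m hm t ht => hm t ⟨ht.1, ht.2.trans hle⟩⟩
  let y : ℝ → E := fun t => if h : t ∈ S then Y h.2.choose t else x
  have hyY : ∀ (T : ℝ) (m : {m : ℝ // 0 < m ∧ m ≤ m₀}), (∀ t ∈ Icc 0 T, Y m t ∈ C m) → EqOn y (Y m) (Icc 0 T) := by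
    intro T m hm t ht
    have htS : t ∈ S := ⟨ht.1, m, fun s hs => hm s ⟨hs.1, hs.2.trans ht.2⟩⟩
    have hyt : y t = Y htS.2.choose t := dif_pos htS
    rw [hyt]
    exact agree' _ m t htS.2.choose_spec (fun s hs => hm s ⟨hs.1, hs.2.trans ht.2⟩)
      ⟨ht.1, le_rfl⟩
  have hext : ∀ (m : ℝ) (m' : {m : ℝ // 0 < m ∧ m ≤ m₀}) (T : ℝ), (m' : ℝ) < m → 0 ≤ T →
      (∀ t ∈ Icc 0 T, Y m' t ∈ C m) → ∃ T' ∈ S, T < T' := by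
    intro m m' T hm hT h
    have h1 : Tendsto (Y m') (𝓝 T) (𝓝[I] (Y m' T)) :=
      tendsto_nhdsWithin_iff.2 ⟨(hYc m').continuousAt,
        Eventually.of_forall (hI m' m'.2.1 m'.2.2 _ (hY0 m') (hYd m'))⟩
    have h2 := h1.eventually (hopen m m' hm _ (h T ⟨hT, le_rfl⟩))
    obtain ⟨ε, hε, hball⟩ := Metric.eventually_nhds_iff_ball.1 h2
    refine ⟨T + ε / 2, ⟨by positivity, m', fun t ht => ?_⟩, by linarith⟩
    rcases le_total t T with htT | htT
    · exact hanti _ _ hm.le (h t ⟨ht.1, htT⟩)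
    · refine hball t ?_
      rw [Metric.mem_ball, Real.dist_eq, abs_lt]
      constructor <;> linarith [ht.2]
  have hpos : ∃ T ∈ S, 0 < T := by
    obtain ⟨m, hm0, hm1, hxm⟩ := hx
    refine hext m ⟨m / 2, by linarith, by linarith⟩ 0 (show m / 2 < m by linarith) le_rfl
      fun t ht => ?_
    rw [le_antisymm ht.2 ht.1, hY0]
    exact hxm
  have hy0 : y 0 = x := by
    obtain ⟨T, ⟨hT, m, hm⟩, -⟩ := hpos
    rw [hyY T m hm ⟨le_rfl, hT⟩, hY0]
  refine ⟨y, hy0, S, ?_, ?_⟩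
  · rintro T ⟨hT, m, hm⟩
    have heq := hyY T m hm
    refine ⟨(hYc m).continuousOn.congr heq, fun t ht => ⟨m, m.2.1, ?_⟩, fun t ht => ?_⟩
    · rw [heq ht]
      exact hm t ht
    · have h1 := hYd m t
      rw [hFV m m.2.1 m.2.2 _ (hm t (Ioo_subset_Icc_self ht)),
        ← heq (Ioo_subset_Icc_self ht)] at h1
      refine h1.congr_of_eventuallyEq ?_
      filter_upwards [isOpen_Ioo.mem_nhds ht] with s hs using heq (Ioo_subset_Icc_self hs)
  · by_cases hbdd : BddAbove S
    · right
      have hlt : ∀ T, 0 ≤ T → T < sSup S → T ∈ S := by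
        intro T hT hTlt
        obtain ⟨T', hT', hTT'⟩ := exists_lt_of_lt_csSup ⟨_, hpos.choose_spec.1⟩ hTlt
        exact hdown T' hT' T hT hTT'.le
      obtain ⟨T₁, hT₁S, hT₁⟩ := hpos
      have hτ : 0 < sSup S := hT₁.trans_le (le_csSup hbdd hT₁S)
      refine ⟨sSup S, hτ, hlt, fun m hm0 hm1 => ?_⟩
      -- A curve staying in `C m` up to the supremum agrees there with the curve of the field for `m
      -- / 2`. By closedness that curve is still in `C m` at the supremum, and by openness it
      -- remains in `C (m / 2)` a little longer.
      by_contra! hcon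
      set m' : {m : ℝ // 0 < m ∧ m ≤ m₀} := ⟨m / 2, by linarith, by linarith⟩
      have hmm : (m' : ℝ) < m := show m / 2 < m by linarith
      have hin : ∀ t ∈ Ico 0 (sSup S), Y m' t ∈ C m := by
        intro t ht
        obtain ⟨-, q, hq⟩ := hlt t ht.1 ht.2
        have heq := hyY t q hq
        have h1 : ∀ s ∈ Icc 0 t, Y q s ∈ C m := fun s hs => by
          rw [← heq hs]; exact hcon s ⟨hs.1, hs.2.trans_lt ht.2⟩
        have htt : t ∈ Icc 0 t := ⟨ht.1, le_rfl⟩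
        rw [← agree q m' t (fun s hs => ⟨hq s hs, hanti _ _ hmm.le (h1 s hs)⟩) htt]
        exact h1 t htt
      have hcl : IsClosed (Y m' ⁻¹' C m) := (hclosed m).preimage (hYc m')
      have h2 := hcl.closure_subset_iff.2 (show Ico 0 (sSup S) ⊆ Y m' ⁻¹' C m from hin)
      rw [closure_Ico hτ.ne] at h2
      obtain ⟨T', hT', hlt'⟩ := hext m m' _ hmm hτ.le fun t ht => h2 ht
      exact absurd (le_csSup hbdd hT') (not_le.2 hlt')
    · left
      intro T hT
      obtain ⟨T', hT', hTT'⟩ := not_bddAbove_iff.1 hbdd T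
      exact hdown T' hT' T hT hTT'.le

section

variable {N : ℕ} {Γ : ℝ → ℝ} {ω : ℝ}

/-- Configurations in the cell of `x`, with the same relative phases inside each cluster and at
distance at least `m` from the walls of the cell. -/
def cellCore (x : Fin N → ℝ) (m : ℝ) : Set (Fin N → ℝ) :=
  {y | (∀ i j, InPhase (x i) (x j) → y i - y j = x i - x j) ∧
    ∀ i j, ¬ InPhase (x i) (x j) → y i - y j - 2 * π * cell x i j ∈ Icc m (2 * π - m)}

theorem cell_eq_of_mem_cellCore {x y : Fin N → ℝ} {m : ℝ} (hm : 0 < m) (hy : y ∈ cellCore x m) :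
    cell y = cell x := by
  ext i j
  rw [cell_eq_iff]
  by_cases h : InPhase (x i) (x j)
  · rw [hy.1 i j h, inPhase_iff_sub_eq_cell.1 h]
    exact ⟨le_rfl, by linarith [two_pi_pos]⟩
  · have := hy.2 i j h
    exact ⟨by linarith [this.1], by linarith [this.2]⟩

theorem mem_cellCore_of_cell_eq {x y : Fin N → ℝ} (hc : cell y = cell x)
    (hin : ∀ i j, InPhase (x i) (x j) → y i - y j = x i - x j) :
    ∃ m, 0 < m ∧ m ≤ π ∧ y ∈ cellCore x m := by
  have h1 : ∀ p : Fin N × Fin N, ∃ m, 0 < m ∧ (¬ InPhase (x p.1) (x p.2) →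
      y p.1 - y p.2 - 2 * π * cell x p.1 p.2 ∈ Icc m (2 * π - m)) := by
    intro p
    by_cases h : InPhase (x p.1) (x p.2)
    · exact ⟨1, one_pos, fun h' => absurd h h'⟩
    · have h2 := sub_cell_mem_Ioo (mt (inPhase_congr hc).1 h)
      rw [hc] at h2
      exact ⟨min (y p.1 - y p.2 - 2 * π * cell x p.1 p.2)
        (2 * π - (y p.1 - y p.2 - 2 * π * cell x p.1 p.2)), lt_min h2.1 (by linarith [h2.2]),
        fun _ => ⟨min_le_left _ _, by
          linarith [min_le_right (y p.1 - y p.2 - 2 * π * cell x p.1 p.2)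
            (2 * π - (y p.1 - y p.2 - 2 * π * cell x p.1 p.2))]⟩⟩
  choose m hm0 hm using h1
  have h3 : ∃ q, 0 < q ∧ ∀ p, q ≤ m p := by
    rcases isEmpty_or_nonempty (Fin N × Fin N) with he | hne
    · exact ⟨1, one_pos, fun p => he.elim p⟩
    · obtain ⟨p₀, hp₀⟩ := Finite.exists_min m
      exact ⟨m p₀, hm0 p₀, hp₀⟩
  obtain ⟨q, hq0, hq⟩ := h3
  refine ⟨min q π, lt_min hq0 pi_pos, min_le_right _ _, hin, fun i j h => ?_⟩
  have h4 := hm (i, j) h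
  have h5 := (min_le_left q π).trans (hq (i, j))
  exact ⟨h5.trans h4.1, by linarith [h4.2]⟩

/-- Extend `Γ` by constants beyond the ends of the compact interval. -/
theorem IsMonotoneCoupling.exists_lipschitz_extension (h : IsMonotoneCoupling Γ)
    (hcurv : HasCurvatureOfConstantSign Γ) {m : ℝ} (hm : 0 < m) (hm' : m ≤ π) :
    ∃ (g : ℝ → ℝ) (K L : NNReal), LipschitzWith K g ∧ (∀ u, |g u| ≤ L) ∧
      EqOn g Γ (Icc m (2 * π - m)) := by
  have hle : m ≤ 2 * π - m := by linarith
  obtain ⟨K, hK⟩ := h.exists_lipschitzOnWith hcurv hm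
  obtain ⟨L, hL⟩ := isCompact_Icc.exists_bound_of_continuousOn hK.continuousOn
  refine ⟨IccExtend hle ((Icc m (2 * π - m)).domRestrict Γ), K * 1, L.toNNReal, ?_, fun u => ?_, ?_⟩
  · exact (lipschitzOnWith_iff_restrict.1 hK).comp (LipschitzWith.projIcc hle)
  · exact (hL _ (projIcc m (2 * π - m) hle u).2).trans (le_coe_toNNReal L)
  · intro u hu
    rw [IccExtend_of_mem _ _ hu]
    rfl

theorem exists_lipschitz_field (g : Fin N → Fin N → ℝ → ℝ) {K L : NNReal}
    (hg : ∀ i j, LipschitzWith K (g i j)) (hL : ∀ i j u, |g i j u| ≤ L) (a : ℝ)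
    (r : Fin N → Fin N) :
    ∃ K' L' : NNReal,
      LipschitzWith K' (fun (y : Fin N → ℝ) k => a + ∑ j, g (r k) j (y (r k) - y j)) ∧
      ∀ y : Fin N → ℝ, ‖fun k => a + ∑ j, g (r k) j (y (r k) - y j)‖ ≤ L' := by
  refine ⟨N * (K * 2), ‖a‖₊ + N * L, LipschitzWith.of_dist_le_mul fun y z => ?_, fun y => ?_⟩
  · refine (dist_pi_le_iff (by positivity)).2 fun k => ?_
    rw [dist_add_left]
    refine (dist_sum_sum_le _ _ _).trans ?_
    refine (Finset.sum_le_card_nsmul _ _ ((K * 2 : NNReal) * dist y z) fun j _ => ?_).trans ?_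
    · refine ((hg (r k) j).dist_le_mul _ _).trans ?_
      have h1 : dist (y (r k) - y j) (z (r k) - z j) ≤ dist y z + dist y z :=
        (dist_sub_sub_le _ _ _ _).trans (add_le_add (dist_le_pi_dist _ _ _) (dist_le_pi_dist _ _ _))
      calc (K : ℝ) * dist (y (r k) - y j) (z (r k) - z j) ≤ K * (dist y z + dist y z) := by gcongr
        _ = (K * 2 : NNReal) * dist y z := by push_cast; ring
    · rw [nsmul_eq_mul, Finset.card_univ, Fintype.card_fin]
      push_cast
      exact le_of_eq (by ring)
  · refine (pi_norm_le_iff_of_nonneg (by positivity)).2 fun k => ?_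
    refine (norm_add_le _ _).trans ?_
    push_cast
    gcongr
    refine (norm_sum_le _ _).trans ?_
    refine (Finset.sum_le_card_nsmul _ _ (L : ℝ) fun j _ => hL _ _ _).trans ?_
    rw [nsmul_eq_mul, Finset.card_univ, Fintype.card_fin]

/-- A choice of one representative in each cluster of in-phase oscillators. -/
theorem exists_cluster_representative (x : Fin N → ℝ) :
    ∃ r : Fin N → Fin N, (∀ k, InPhase (x (r k)) (x k)) ∧
      ∀ i j, InPhase (x i) (x j) → r i = r j := by
  let p : Real.Angle → Fin N → Prop := fun a k => (x k : Real.Angle) = a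
  have hp : ∀ k, ∃ l, p (x k) l := fun k => ⟨k, rfl⟩
  refine ⟨fun k => (hp k).choose, fun k => (hp k).choose_spec, fun i j hij => ?_⟩
  have hij' : (x i : Real.Angle) = x j := hij
  simp only [hij']

/-- Each component is evaluated at its cluster representative, and in-phase terms are frozen at `Γ
0`. Hence cluster members have exactly equal velocities everywhere, even outside the core, and
integral curves preserve the relative phases inside clusters. -/
theorem IsMonotoneCoupling.exists_cellCore_field (h : IsMonotoneCoupling Γ)
    (hcurv : HasCurvatureOfConstantSign Γ) (ω : ℝ) (x : Fin N → ℝ) {m : ℝ} (hm : 0 < m)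
    (hm' : m ≤ π) :
    ∃ F : (Fin N → ℝ) → Fin N → ℝ,
      (∃ K L : NNReal, LipschitzWith K F ∧ ∀ y, ‖F y‖ ≤ L) ∧
      (∀ y i j, InPhase (x i) (x j) → F y i = F y j) ∧
      ∀ y ∈ cellCore x m, F y = phaseVelocity Γ ω y := by
  classical
  obtain ⟨g, K, L, hK, hL, hg⟩ := h.exists_lipschitz_extension hcurv hm hm'
  obtain ⟨r, hr, hr'⟩ := exists_cluster_representative x
  let G : Fin N → Fin N → ℝ → ℝ := fun i j u =>
    if InPhase (x i) (x j) then Γ 0 else g (u - 2 * π * cell x i j)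
  have hGK : ∀ i j, LipschitzWith K (G i j) := by
    intro i j
    by_cases hij : InPhase (x i) (x j)
    · simp only [G, if_pos hij]
      exact (LipschitzWith.const (Γ 0)).weaken zero_le
    · simp only [G, if_neg hij]
      refine LipschitzWith.of_dist_le_mul fun u v => ?_
      have := hK.dist_le_mul (u - 2 * π * cell x i j) (v - 2 * π * cell x i j)
      rwa [dist_sub_right] at this
  have hGL : ∀ i j u, |G i j u| ≤ (L + ‖Γ 0‖₊ : NNReal) := by
    intro i j u
    push_cast
    by_cases hij : InPhase (x i) (x j)
    · simp only [G, if_pos hij]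
      exact le_add_of_nonneg_left L.2
    · simp only [G, if_neg hij]
      exact (hL _).trans (le_add_of_nonneg_right (norm_nonneg _))
  refine ⟨fun y k => (ω - Γ 0) + ∑ j, G (r k) j (y (r k) - y j),
    exists_lipschitz_field G hGK hGL _ r, fun y i j hij => by simp only [hr' i j hij], ?_⟩
  intro y hy
  ext k
  have hk : InPhase (y (r k)) (y k) := by
    have h1 := hr k
    rw [inPhase_iff] at h1 ⊢
    rw [hy.1 _ _ (hr k)]
    exact h1
  rw [← phaseVelocity_eq_of_inPhase h.periodic hk, phaseVelocity_eq]
  refine congrArg ((ω - Γ 0) + ·) ?_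
  refine Finset.sum_congr rfl fun j _ => ?_
  by_cases hij : InPhase (x (r k)) (x j)
  · simp only [G, if_pos hij]
    rw [hy.1 _ _ hij, inPhase_iff_sub_eq_cell.1 hij,
      ← h.periodic.apply_sub_two_pi_mul (2 * π * _) (cell x (r k) j), sub_self]
  · simp only [G, if_neg hij]
    rw [hg (hy.2 _ _ hij), h.periodic.apply_sub_two_pi_mul]

/-- Maximal solutions in a cell: they are global or approach the walls of the cell. -/
theorem IsMonotoneCoupling.exists_isCellSolution (h : IsMonotoneCoupling Γ)
    (hcurv : HasCurvatureOfConstantSign Γ) (ω : ℝ) (x : Fin N → ℝ) :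
    ∃ y : ℝ → Fin N → ℝ, y 0 = x ∧ ((∀ T, IsCellSolution Γ ω (cell x) y T) ∨
      ∃ τ, 0 < τ ∧ (∀ T < τ, IsCellSolution Γ ω (cell x) y T) ∧
        ∀ m, 0 < m → m ≤ π → ∃ t ∈ Ico 0 τ, y t ∉ cellCore x m) := by
  classical
  choose! F hF1 hF2 hF3 using fun (m : ℝ) (hm : 0 < m) (hm' : m ≤ π) =>
    h.exists_cellCore_field hcurv ω x hm hm'
  have hanti : ∀ m m', m' ≤ m → cellCore x m ⊆ cellCore x m' :=
    fun m m' hm y hy => ⟨hy.1, fun i j hij =>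
      ⟨hm.trans (hy.2 i j hij).1, by linarith [(hy.2 i j hij).2]⟩⟩
  have hclosed : ∀ m, IsClosed (cellCore x m) := by
    intro m
    have : cellCore x m = (⋂ i, ⋂ j, {y | InPhase (x i) (x j) → y i - y j = x i - x j}) ∩
        ⋂ i, ⋂ j, {y | ¬ InPhase (x i) (x j) →
          y i - y j - 2 * π * cell x i j ∈ Icc m (2 * π - m)} := by
      ext y
      simp [cellCore]
    rw [this]
    refine (isClosed_iInter fun i => isClosed_iInter fun j => ?_).inter
      (isClosed_iInter fun i => isClosed_iInter fun j => ?_)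
    · by_cases hij : InPhase (x i) (x j)
      · simp only [hij, true_imp_iff]
        exact isClosed_eq (by fun_prop) (by fun_prop)
      · simp [hij]
    · by_cases hij : InPhase (x i) (x j)
      · simp [hij]
      · simp only [hij, not_false_eq_true, true_imp_iff]
        exact isClosed_Icc.preimage
          (f := fun y : Fin N → ℝ => y i - y j - 2 * π * cell x i j) (by fun_prop)
  -- Fixing the differences within clusters can make a core have empty interior; openness is
  -- therefore only required relative to this invariant affine subspace.
  have hI : ∀ m, 0 < m → m ≤ π → ∀ z : ℝ → Fin N → ℝ, z 0 = x →
      (∀ t, HasDerivAt z (F m (z t)) t) → ∀ t, z t ∈ {y : Fin N → ℝ |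
        ∀ i j, InPhase (x i) (x j) → y i - y j = x i - x j} := by
    intro m hm hm' z hz0 hz t i j hij
    have hd : ∀ s, HasDerivAt (fun s => z s i - z s j) 0 s := fun s => by
      have h1 := (hasDerivAt_pi.1 (hz s) i).sub (hasDerivAt_pi.1 (hz s) j)
      rwa [hF2 m hm hm' (z s) i j hij, sub_self] at h1
    have := is_const_of_deriv_eq_zero (fun s => (hd s).differentiableAt) (fun s => (hd s).deriv) t 0
    simpa [hz0] using this
  have hopen : ∀ m m', m' < m → ∀ y ∈ cellCore x m, ∀ᶠ z in 𝓝[{y : Fin N → ℝ |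
      ∀ i j, InPhase (x i) (x j) → y i - y j = x i - x j}] y, z ∈ cellCore x m' := by
    intro m m' hm y hy
    have h1 : ∀ i j, ∀ᶠ z : Fin N → ℝ in 𝓝 y, ¬ InPhase (x i) (x j) →
        z i - z j - 2 * π * cell x i j ∈ Icc m' (2 * π - m') := by
      intro i j
      by_cases hij : InPhase (x i) (x j)
      · exact Eventually.of_forall fun z h => absurd hij h
      · have h2 := hy.2 i j hij
        have hc : ContinuousAt (fun z : Fin N → ℝ => z i - z j - 2 * π * cell x i j) y := by
          fun_prop
        filter_upwards [hc (Icc_mem_nhds (hm.trans_le h2.1)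
          (show _ < 2 * π - m' by linarith [h2.2]))] with z hz _ using hz
    filter_upwards [self_mem_nhdsWithin, nhdsWithin_le_nhds
      (eventually_all.2 fun i => eventually_all.2 fun j => h1 i j)] with z hz1 hz2
    exact ⟨hz1, hz2⟩
  obtain ⟨y, hy0, S, hS, hcase⟩ := exists_maximal_integralCurve hF1 hF3 hanti hclosed
    (mem_cellCore_of_cell_eq rfl fun _ _ _ => rfl) hI hopen
  have key : ∀ T ∈ S, IsCellSolution Γ ω (cell x) y T := fun T hT => by
    obtain ⟨h1, h2, h3⟩ := hS T hT
    refine ⟨h1, fun t ht => ?_, fun t ht k => hasDerivAt_pi.1 (h3 t ht) k⟩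
    obtain ⟨m, hm, hym⟩ := h2 t (Ioo_subset_Icc_self ht)
    exact cell_eq_of_mem_cellCore hm hym
  refine ⟨y, hy0, ?_⟩
  rcases hcase with h1 | ⟨τ, hτ, h1, h2⟩
  · exact Or.inl fun T => (key _ (h1 (max T 0) (le_max_right _ _))).mono (le_max_left _ _)
  · exact Or.inr ⟨τ, hτ, fun T hT =>
      (key _ (h1 (max T 0) (le_max_right _ _) (max_lt hT hτ))).mono (le_max_left _ _), h2⟩

end

/-! ### Decreasing coupling: ordered phases and the splay state -/

section

variable {N n : ℕ} {Γ : ℝ → ℝ} {ω c : ℝ}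

/-- Almost every configuration has pairwise distinct phases. -/
theorem ae_forall_not_inPhase (N : ℕ) :
    ∀ᵐ x : Fin N → ℝ, ∀ i j, i ≠ j → ¬ InPhase (x i) (x j) := by
  refine ae_all_iff.2 fun i => ae_all_iff.2 fun j => ?_
  by_cases hij : i = j
  · simp [hij]
  have h1 : ∀ n : ℤ, ∀ᵐ x : Fin N → ℝ, x i - x j ≠ 2 * π * n := by
    intro n
    -- The exceptional set is a translate of the kernel of a nonzero linear form, a proper subspace
    -- and hence null.
    let L : (Fin N → ℝ) →ₗ[ℝ] ℝ := (LinearMap.proj i : (Fin N → ℝ) →ₗ[ℝ] ℝ) - LinearMap.proj j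
    have hL : LinearMap.ker L ≠ ⊤ := by
      intro htop
      have : (Pi.single i 1 : Fin N → ℝ) ∈ LinearMap.ker L := by rw [htop]; trivial
      simp [L, Pi.single_eq_of_ne (Ne.symm hij)] at this
    have h0 := Measure.addHaar_submodule (volume : Measure (Fin N → ℝ)) _ hL
    rw [ae_iff]
    rw [← measure_preimage_add_right volume (Pi.single i (-(2 * π * n)) : Fin N → ℝ)] at h0
    refine measure_mono_null (fun x hx => ?_) h0
    have hx' : x i - x j = 2 * π * n := not_not.1 hx
    simp only [mem_preimage, SetLike.mem_coe, LinearMap.mem_ker, L, LinearMap.sub_apply,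
      LinearMap.proj_apply, Pi.add_apply, Pi.single_eq_same, Pi.single_eq_of_ne (Ne.symm hij)]
    linarith
  filter_upwards [ae_all_iff.2 h1] with x hx _ hin
  obtain ⟨n, hn⟩ := inPhase_iff.1 hin
  exact hx n hn

/-- The phases are listed in increasing order along one turn of the circle. -/
def IsPhaseOrdered [NeZero N] (x : Fin N → ℝ) : Prop := StrictMono x ∧ ∀ k, x k < x 0 + 2 * π

/-- All ordered configurations, including the splay state and all cyclic relabellings, share this
one cell, which is what makes them comparable. -/
theorem IsPhaseOrdered.cell_eq [NeZero N] {x : Fin N → ℝ} (h : IsPhaseOrdered x) (i j : Fin N) :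
    cell x i j = if j ≤ i then 0 else -1 := by
  have h0 : ∀ k, x 0 ≤ x k := fun k => h.1.monotone (Fin.zero_le k)
  rw [cell_eq_iff]
  split_ifs with hij
  · have := h.1.monotone hij
    push_cast
    constructor <;> linarith [h.2 i, h0 j]
  · have := h.1 (not_le.1 hij)
    push_cast
    constructor <;> linarith [h.2 j, h0 i]

theorem IsPhaseOrdered.cell_eq_cell [NeZero N] {x y : Fin N → ℝ} (hx : IsPhaseOrdered x)
    (hy : IsPhaseOrdered y) : cell x = cell y := by
  ext i j
  rw [hx.cell_eq, hy.cell_eq]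

theorem IsPhaseOrdered.of_cell_eq [NeZero N] {x y : Fin N → ℝ} (hx : IsPhaseOrdered x)
    (h : cell y = cell x) : IsPhaseOrdered y := by
  constructor
  · intro i j hij
    have h1 := lt_cell_add_one y i j
    rw [h, hx.cell_eq, if_neg (not_le.2 hij)] at h1
    push_cast at h1
    linarith
  · intro k
    have h1 := lt_cell_add_one y k 0
    rw [h, hx.cell_eq, if_pos (Fin.zero_le k)] at h1
    push_cast at h1
    linarith

theorem IsPhaseOrdered.eq_of_inPhase [NeZero N] {x : Fin N → ℝ} (hx : IsPhaseOrdered x)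
    {i j : Fin N} (h : InPhase (x i) (x j)) : i = j := by
  rw [inPhase_iff_cell, hx.cell_eq, hx.cell_eq] at h
  by_contra hne
  rcases lt_or_gt_of_ne hne with hlt | hlt
  · rw [if_neg (not_le.2 hlt), if_pos hlt.le] at h
    omega
  · rw [if_pos hlt.le, if_neg (not_le.2 hlt)] at h
    omega

/-- The winding numbers of the relabelling `k ↦ k + 1` of an ordered configuration. -/
def rotateWinding (k : Fin (n + 1)) : ℤ := if k = Fin.last n then 1 else 0

/-- The configuration with each oscillator replaced by the next one along the circle. -/
noncomputable def rotate (x : Fin (n + 1) → ℝ) (k : Fin (n + 1)) : ℝ :=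
  x (finRotate (n + 1) k) + 2 * π * rotateWinding k

theorem rotate_castSucc (x : Fin (n + 1) → ℝ) (k : Fin n) : rotate x k.castSucc = x k.succ := by
  simp [rotate, rotateWinding, (Fin.castSucc_lt_last k).ne]

theorem rotate_last (x : Fin (n + 1) → ℝ) : rotate x (Fin.last n) = x 0 + 2 * π := by
  simp [rotate, rotateWinding]

theorem rotate_rotate_sub (x : Fin (n + 1) → ℝ) (k : Fin (n + 1)) :
    rotate (rotate x) k - rotate x k
      = rotate x (finRotate (n + 1) k) - x (finRotate (n + 1) k) := by
  rw [rotate, rotate.eq_def x k]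
  ring

/-- The numbers `rotate x k - x k` are the `n + 1` gaps around the circle, the last one closing the
turn. -/
theorem isPhaseOrdered_iff {x : Fin (n + 1) → ℝ} :
    IsPhaseOrdered x ↔ ∀ k, 0 < rotate x k - x k := by
  constructor
  · intro h k
    induction k using Fin.lastCases with
    | last => rw [rotate_last]; linarith [h.2 (Fin.last n)]
    | cast k => rw [rotate_castSucc]; linarith [h.1 (Fin.castSucc_lt_succ (i := k))]
  · intro h
    have hm : StrictMono x := Fin.strictMono_iff_lt_succ.2 fun k => by
      have := h k.castSucc
      rw [rotate_castSucc] at this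
      linarith
    refine ⟨hm, fun k => ?_⟩
    have h1 := h (Fin.last n)
    rw [rotate_last] at h1
    linarith [hm.monotone (Fin.le_last k)]

theorem IsPhaseOrdered.rotate {x : Fin (n + 1) → ℝ} (h : IsPhaseOrdered x) :
    IsPhaseOrdered (rotate x) := by
  rw [isPhaseOrdered_iff] at h ⊢
  intro k
  rw [rotate_rotate_sub]
  exact h _

theorem phaseVelocity_rotate (hp : Function.Periodic Γ (2 * π)) (x : Fin (n + 1) → ℝ)
    (k : Fin (n + 1)) :
    phaseVelocity Γ ω (rotate x) k = phaseVelocity Γ ω x (finRotate (n + 1) k) :=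
  phaseVelocity_relabel hp x (finRotate (n + 1)) rotateWinding k

/-- For ordered phases, the smallest gap between neighbours does not decrease. -/
theorem IsCellSolution.le_rotate_sub {y : ℝ → Fin (n + 1) → ℝ} {x : Fin (n + 1) → ℝ} {T m : ℝ}
    (hΓ : IsRepulsive Γ c) (hx : IsPhaseOrdered x) (hy : IsCellSolution Γ ω (cell x) y T)
    (hm : ∀ k, m ≤ rotate (y 0) k - y 0 k) : ∀ t ∈ Icc 0 T, ∀ k, m ≤ rotate (y t) k - y t k := by
  -- The rotated curve solves the same equation in the same cell, so the gaps are the displacement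
  -- between two comparable solutions.
  have hrot : IsCellSolution Γ ω (cell x) (fun t => rotate (y t)) T := by
    refine ⟨?_, fun t ht => ?_, fun t ht k => ?_⟩
    · rw [continuousOn_pi]
      exact fun k => (hy.continuousOn_apply _).add continuousOn_const
    · exact ((hx.of_cell_eq (hy.cell_eq t ht)).rotate).cell_eq_cell hx
    · rw [phaseVelocity_rotate hΓ.periodic]
      exact (hy.hasDerivAt t ht _).add_const _
  exact hy.le_sub hΓ hrot hm

theorem exists_pos_le_of_forall_pos {ι : Type*} [Finite ι] {f : ι → ℝ} (h : ∀ i, 0 < f i) :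
    ∃ m, 0 < m ∧ ∀ i, m ≤ f i := by
  rcases isEmpty_or_nonempty ι with he | hne
  · exact ⟨1, one_pos, fun i => he.elim i⟩
  · obtain ⟨i, hi⟩ := Finite.exists_min f
    exact ⟨f i, h i, hi⟩

/-- Ordered phases never collide under repulsive coupling. -/
theorem IsNetworkSolution.cell_eq_of_isPhaseOrdered {x : Fin (n + 1) → ℝ}
    {θ : ℝ → Fin (n + 1) → ℝ} (hΓ : IsRepulsive Γ c) (hc : ContinuousOn Γ (Ioo 0 (2 * π)))
    (hx : IsPhaseOrdered x) (h : IsNetworkSolution Γ ω x θ) {t : ℝ} (ht : 0 ≤ t) :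
    cell (θ t) = cell x := by
  rcases h.forall_cell_eq_or_exists with h1 | ⟨τ, hτ, h1, i, j, hij, hin⟩
  · exact h1 t ht
  · exfalso
    have hsol : IsCellSolution Γ ω (cell x) θ τ :=
      h.isCellSolution hΓ.periodic hc fun s hs => h1 s hs.1.le hs.2
    obtain ⟨m, hm0, hm⟩ := exists_pos_le_of_forall_pos (isPhaseOrdered_iff.1 hx)
    have h2 := hsol.le_rotate_sub hΓ hx (by rwa [h.apply_zero]) τ ⟨hτ.le, le_rfl⟩
    have h3 : IsPhaseOrdered (θ τ) := isPhaseOrdered_iff.2 fun k => hm0.trans_le (h2 k)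
    exact hij ((inPhase_congr (hx.cell_eq_cell h3)).2 hin)

/-- Any two phases are at least one neighbouring gap apart, and at most a full turn minus the
closing gap. -/
theorem mem_cellCore_of_le_rotate_sub {x y : Fin (n + 1) → ℝ} (hx : IsPhaseOrdered x) {m : ℝ}
    (hm : 0 < m) (h : ∀ k, m ≤ rotate y k - y k) : y ∈ cellCore x m := by
  have hy : IsPhaseOrdered y := isPhaseOrdered_iff.2 fun k => hm.trans_le (h k)
  have hlow : ∀ i j, j < i → m ≤ y i - y j := by
    intro i j hij
    obtain ⟨j', rfl⟩ := Fin.exists_castSucc_eq.2 (hij.trans_le (Fin.le_last i)).ne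
    have h1 := h j'.castSucc
    rw [rotate_castSucc] at h1
    linarith [hy.1.monotone (Fin.castSucc_lt_iff_succ_le.1 hij)]
  have hup : ∀ i j, y i - y j ≤ 2 * π - m := by
    intro i j
    have h1 := h (Fin.last n)
    rw [rotate_last] at h1
    linarith [hy.1.monotone (Fin.le_last i), hy.1.monotone (Fin.zero_le j)]
  refine ⟨fun i j hij => by rw [hx.eq_of_inPhase hij, sub_self, sub_self], fun i j hij => ?_⟩
  have hne : i ≠ j := fun heq => hij (heq ▸ InPhase.refl _)
  rw [hx.cell_eq]
  rcases lt_or_gt_of_ne hne with hlt | hlt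
  · rw [if_neg (not_le.2 hlt)]
    push_cast
    constructor <;> linarith [hlow j i hlt, hup j i]
  · rw [if_pos hlt.le]
    push_cast
    constructor <;> linarith [hlow i j hlt, hup i j]

/-- Leaving every core in finite time is impossible, because the smallest gap never drops below its
initial value. -/
theorem IsMonotoneCoupling.exists_isNetworkSolution_of_isPhaseOrdered (h : IsMonotoneCoupling Γ)
    (hcurv : HasCurvatureOfConstantSign Γ) (hΓ : IsRepulsive Γ c) (ω : ℝ) {x : Fin (n + 1) → ℝ}
    (hx : IsPhaseOrdered x) : ∃ θ, IsNetworkSolution Γ ω x θ := by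
  obtain ⟨y, hy0, hy⟩ := h.exists_isCellSolution hcurv ω x
  rcases hy with hy | ⟨τ, hτ, hy, hexit⟩
  · refine ⟨y, ?_⟩
    rw [← hy0] at hy ⊢
    exact IsCellSolution.isNetworkSolution h.periodic h.continuousOn hy
  · exfalso
    obtain ⟨m, hm0, hm⟩ := exists_pos_le_of_forall_pos (isPhaseOrdered_iff.1 hx)
    obtain ⟨t, ht, hty⟩ := hexit (min m π) (lt_min hm0 pi_pos) (min_le_right _ _)
    refine hty (mem_cellCore_of_le_rotate_sub hx (lt_min hm0 pi_pos) ?_)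
    exact (hy t ht.2).le_rotate_sub hΓ hx
      (fun k => by rw [hy0]; exact (min_le_left _ _).trans (hm k)) t ⟨ht.1, le_rfl⟩

/-- The splay state: phases equally spaced around the circle. -/
noncomputable def splay (N : ℕ) (k : Fin N) : ℝ := 2 * π * (k : ℕ) / N

theorem rotate_splay_sub (k : Fin (n + 1)) :
    rotate (splay (n + 1)) k - splay (n + 1) k = 2 * π / (n + 1 : ℕ) := by
  have hn : ((n : ℝ) + 1) ≠ 0 := by positivity
  induction k using Fin.lastCases with
  | last =>
    rw [rotate_last]
    simp only [splay, Fin.val_zero, Fin.val_last]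
    push_cast
    field_simp
    ring
  | cast k =>
    rw [rotate_castSucc]
    simp only [splay, Fin.val_succ, Fin.val_castSucc]
    push_cast
    field_simp
    ring

theorem isPhaseOrdered_splay : IsPhaseOrdered (splay (n + 1)) :=
  isPhaseOrdered_iff.2 fun k => by rw [rotate_splay_sub]; positivity

/-- Rotation adds the same constant to every splay phase, so neighbouring oscillators have equal
velocities. -/
theorem phaseVelocity_splay (hp : Function.Periodic Γ (2 * π)) (k : Fin (n + 1)) :
    phaseVelocity Γ ω (splay (n + 1)) k = phaseVelocity Γ ω (splay (n + 1)) 0 := by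
  induction k using Fin.induction with
  | zero => rfl
  | succ k ih =>
    rw [← ih, ← phaseVelocity_congr_sub (x := rotate (splay (n + 1))) (k := k.castSucc) fun i j => by
        linarith [rotate_splay_sub i, rotate_splay_sub j],
      phaseVelocity_rotate hp]
    simp

/-- The splay state is the only phase-locked state with ordered, distinct phases. -/
theorem IsRepulsive.phaseLocked_iff_splay (hΓ : IsRepulsive Γ c) {x : Fin (n + 1) → ℝ}
    (hx : IsPhaseOrdered x) :
    (∀ k, phaseVelocity Γ ω x k = phaseVelocity Γ ω x 0) ↔ ∀ k, x k - x 0 = splay (n + 1) k := by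
  have hs0 : splay (n + 1) 0 = 0 := by simp [splay]
  constructor
  · intro h k
    have := hΓ.sub_eq_of_phaseLocked (ω := ω) (isPhaseOrdered_splay.cell_eq_cell hx)
      (fun i j => by rw [phaseVelocity_splay hΓ.periodic i, phaseVelocity_splay hΓ.periodic j])
      (fun i j => by rw [h i, h j]) k 0
    linarith
  · intro h k
    have key : ∀ k, phaseVelocity Γ ω x k = phaseVelocity Γ ω (splay (n + 1)) k :=
      phaseVelocity_congr_sub fun i j => by linarith [h i, h j]
    rw [key, key, phaseVelocity_splay hΓ.periodic]

/-- The splay state rotating with its common velocity `Ω` is a solution in the same cell; the spread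
of the displacement from it decays exponentially. -/
theorem IsNetworkSolution.tendsto_splay {x : Fin (n + 1) → ℝ} {θ : ℝ → Fin (n + 1) → ℝ}
    (hΓ : IsRepulsive Γ c) (hc : ContinuousOn Γ (Ioo 0 (2 * π))) (hx : IsPhaseOrdered x)
    (h : IsNetworkSolution Γ ω x θ) (k : Fin (n + 1)) :
    Tendsto (fun t => θ t k - θ t 0) atTop (𝓝 (splay (n + 1) k)) := by
  set Ω := phaseVelocity Γ ω (splay (n + 1)) 0
  set s : ℝ → Fin (n + 1) → ℝ := fun t k => splay (n + 1) k + Ω * t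
  have hsub : ∀ t i j, s t i - s t j = splay (n + 1) i - splay (n + 1) j := fun t i j => by
    simp only [s]; ring
  have hs : ∀ T, IsCellSolution Γ ω (cell x) s T := fun T => by
    refine ⟨by fun_prop, fun t _ => ?_, fun t _ k => ?_⟩
    · rw [hx.cell_eq_cell isPhaseOrdered_splay]
      ext i j
      simp only [cell, hsub]
    · rw [phaseVelocity_congr_sub (hsub t), phaseVelocity_splay hΓ.periodic]
      have := ((hasDerivAt_id t).const_mul Ω).const_add (splay (n + 1) k)
      rw [mul_one] at this
      exact this
  have hθ : ∀ T, IsCellSolution Γ ω (cell x) θ T := fun T =>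
    h.isCellSolution hΓ.periodic hc fun t ht => h.cell_eq_of_isPhaseOrdered hΓ hc hx ht.1.le
  obtain ⟨A, hA⟩ := (Set.finite_range fun p : Fin (n + 1) × Fin (n + 1) =>
    (θ 0 p.1 - s 0 p.1) - (θ 0 p.2 - s 0 p.2)).bddAbove
  have hbound : ∀ t, 0 ≤ t → ∀ i j, (θ t i - s t i) - (θ t j - s t j) ≤ A * exp (-(c * t)) := by
    intro t ht i j
    have h1 := (hs t).exp_mul_sub_sub_le hΓ (hθ t) (fun i j => hA ⟨(i, j), rfl⟩) t ⟨ht, le_rfl⟩ i j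
    rw [exp_neg, ← div_eq_mul_inv, le_div_iff₀ (exp_pos _)]
    linarith
  have hlim : Tendsto (fun t => A * exp (-(c * t))) atTop (𝓝 0) := by
    have := (tendsto_exp_neg_atTop_nhds_zero.comp
      (tendsto_id.const_mul_atTop hΓ.pos)).const_mul A
    simpa using this
  have hs0 : splay (n + 1) 0 = 0 := by simp [splay]
  have hz : Tendsto (fun t => (θ t k - θ t 0) - splay (n + 1) k) atTop (𝓝 0) := by
    refine squeeze_zero_norm' ?_ hlim
    filter_upwards [eventually_ge_atTop 0] with t ht
    have h1 := hbound t ht k 0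
    have h2 := hbound t ht 0 k
    have h3 := hsub t k 0
    rw [Real.norm_eq_abs, abs_le]
    constructor <;> linarith
  simpa using hz.add_const (splay (n + 1) k)

/-- Configurations with distinct phases can be relabelled and lifted to an ordered one. -/
theorem exists_relabel_isPhaseOrdered [NeZero N] {x : Fin N → ℝ}
    (hx : ∀ i j, i ≠ j → ¬ InPhase (x i) (x j)) :
    ∃ (σ : Equiv.Perm (Fin N)) (z : Fin N → ℤ), σ 0 = 0 ∧
      StrictMono (fun k => phaseDiff (x (σ k)) (x 0)) ∧
      IsPhaseOrdered fun k => x (σ k) + 2 * π * z k := by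
  set f : Fin N → ℝ := fun k => phaseDiff (x k) (x 0) with hf
  set d : Fin N → ℤ := fun k => toIcoDiv two_pi_pos 0 (x k - x 0) with hd
  have hfd : ∀ k, f k = x k - x 0 - 2 * π * d k := fun k => by
    simp only [hf, hd, phaseDiff, toIcoMod, zsmul_eq_mul]
    ring
  have hmem : ∀ k, 0 ≤ f k ∧ f k < 2 * π := fun k => by
    have := toIcoMod_mem_Ico two_pi_pos 0 (x k - x 0)
    rw [zero_add] at this
    exact this
  have hinj : Function.Injective f := by
    intro i j hij
    by_contra hne
    refine hx i j hne (inPhase_iff.2 ⟨d i - d j, ?_⟩)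
    rw [hfd, hfd] at hij
    push_cast
    linarith
  have hf0 : f 0 = 0 := by simp [hf, phaseDiff]
  have hsm : StrictMono (f ∘ Tuple.sort f) :=
    (Tuple.monotone_sort f).strictMono_of_injective (hinj.comp (Tuple.sort f).injective)
  have hσ0 : Tuple.sort f 0 = 0 := by
    refine hinj (le_antisymm ?_ ?_)
    · have h1 := hsm.monotone (Fin.zero_le ((Tuple.sort f).symm 0))
      simpa using h1
    · rw [hf0]
      exact (hmem _).1
  refine ⟨Tuple.sort f, fun k => -d (Tuple.sort f k), hσ0, hsm, ?_⟩
  have hval : ∀ k, x (Tuple.sort f k) + 2 * π * ((-d (Tuple.sort f k) : ℤ) : ℝ)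
      = x 0 + (f ∘ Tuple.sort f) k := fun k => by
    simp only [Function.comp, hfd]
    push_cast
    ring
  simp only [hval]
  refine ⟨fun i j hij => by simpa using hsm hij, fun k => ?_⟩
  simp only [Function.comp, hσ0, hf0]
  linarith [(hmem (Tuple.sort f k)).2]

theorem phaseDiff_eq_of_mem {a b d : ℝ} (hd : d ∈ Ico 0 (2 * π)) (m : ℤ)
    (h : a - b = d + 2 * π * m) : phaseDiff a b = d := by
  rw [phaseDiff, toIcoMod_eq_iff]
  refine ⟨by rwa [zero_add], m, ?_⟩
  rw [h, zsmul_eq_mul]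
  ring

/-- Repulsive coupling: convergence to the splay state. -/
theorem IsMonotoneCoupling.ae_tendsto_splay (h : IsMonotoneCoupling Γ)
    (hcurv : HasCurvatureOfConstantSign Γ) (hΓ : IsRepulsive Γ c) (ω : ℝ) :
    ∀ᵐ x : Fin (n + 1) → ℝ, (∃ θ, IsNetworkSolution Γ ω x θ) ∧
      ∃ σ : Equiv.Perm (Fin (n + 1)), σ 0 = 0 ∧
        StrictMono (fun k => phaseDiff (x (σ k)) (x 0)) ∧
        ∀ θ : ℝ → Fin (n + 1) → ℝ, IsNetworkSolution Γ ω x θ → ∀ k,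
          Tendsto (fun t => phaseDiff (θ t (σ k)) (θ t 0)) atTop (𝓝 (splay (n + 1) k)) := by
  filter_upwards [ae_forall_not_inPhase (n + 1)] with x hx
  obtain ⟨σ, z, hσ0, hmono, hord⟩ := exists_relabel_isPhaseOrdered hx
  refine ⟨?_, σ, hσ0, hmono, fun θ hθ k => ?_⟩
  · obtain ⟨θ, hθ⟩ := h.exists_isNetworkSolution_of_isPhaseOrdered hcurv hΓ ω hord
    have := hθ.relabel h.periodic σ.symm fun k => -z (σ.symm k)
    simp only [Equiv.apply_symm_apply, Int.cast_neg, mul_neg, add_neg_cancel_right] at this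
    exact ⟨_, this⟩
  · have hrel := hθ.relabel h.periodic σ z
    refine (hrel.tendsto_splay hΓ h.continuousOn hord k).congr' ?_
    filter_upwards [eventually_ge_atTop 0] with t ht
    have ho := hord.of_cell_eq (hrel.cell_eq_of_isPhaseOrdered hΓ h.continuousOn hord ht)
    symm
    -- The lifted phases stay ordered within one turn, so their difference from the reference is
    -- already the representative in `[0, 2π)`.
    refine phaseDiff_eq_of_mem ⟨?_, ?_⟩ (z 0 - z k) ?_
    · exact sub_nonneg.2 (ho.1.monotone (Fin.zero_le k))
    · exact sub_left_lt_of_lt_add (ho.2 k)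
    · simp only [hσ0]
      push_cast
      ring

end

/-! ### Increasing coupling: null exceptional set and finite-time synchronization -/

/-- A set covered by countably many pieces, each of which is mapped to `ℝ^d` by a map with
Lipschitz inverse. -/
def IsThin {N : ℕ} (d : ℕ) (S : Set (Fin N → ℝ)) : Prop :=
  ∃ (ι : Type) (_ : Countable ι) (A : ι → Set (Fin N → ℝ)), S ⊆ ⋃ i, A i ∧
    ∀ i, ∃ (g : (Fin N → ℝ) → Fin d → ℝ) (C : ℝ), 0 ≤ C ∧
      ∀ x ∈ A i, ∀ y ∈ A i, dist x y ≤ C * dist (g x) (g y)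

/-- Each piece is a Lipschitz image of a subset of `ℝ^d`, so its Hausdorff dimension is at most `d <
N`. No measurability of the pieces or of the maps is needed. -/
theorem IsThin.volume_eq_zero {N d : ℕ} (hd : d < N) {S : Set (Fin N → ℝ)} (h : IsThin d S) :
    volume S = 0 := by
  obtain ⟨ι, _, A, hSA, hA⟩ := h
  refine measure_mono_null hSA (measure_iUnion_null fun i => ?_)
  obtain ⟨g, C, hC, hg⟩ := hA i
  have hinj : InjOn g (A i) := fun x hx y hy hxy => by
    have := hg x hx y hy
    rw [hxy, dist_self, mul_zero] at this
    exact dist_le_zero.1 this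
  have hinv : ∀ x ∈ A i, Function.invFunOn g (A i) (g x) = x := fun x hx =>
    hinj.leftInvOn_invFunOn hx
  have hlip : LipschitzOnWith C.toNNReal (Function.invFunOn g (A i)) (g '' A i) := by
    refine LipschitzOnWith.of_dist_le_mul ?_
    rintro _ ⟨x, hx, rfl⟩ _ ⟨y, hy, rfl⟩
    rw [hinv x hx, hinv y hy, coe_toNNReal C hC]
    exact hg x hx y hy
  have himg : Function.invFunOn g (A i) '' (g '' A i) = A i := by
    rw [image_image]
    exact (image_congr hinv).trans (image_id' _)
  have hdim : dimH (A i) < (N : NNReal) := by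
    rw [← himg]
    refine (hlip.dimH_image_le.trans (dimH_mono (subset_univ _))).trans_lt ?_
    rw [dimH_univ_pi_fin]
    exact_mod_cast hd
  have := hausdorffMeasure_of_dimH_lt hdim
  rw [← hausdorffMeasure_pi_real, Fintype.card_fin]
  exact_mod_cast this

section

variable {N : ℕ} {Γ : ℝ → ℝ} {ω r T A : ℝ} {c : Fin N → Fin N → ℤ}

namespace IsCellSolution

variable {x y : ℝ → Fin N → ℝ}

/-- For attractive coupling, displacements do not grow backwards in time. -/
theorem sub_le_of_sub_le (hΓ : IsRepulsive (fun u => -Γ u) r) (hx : IsCellSolution Γ ω c x T)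
    (hy : IsCellSolution Γ ω c y T) (h : ∀ k, y T k - x T k ≤ A) :
    ∀ t ∈ Icc 0 T, ∀ k, y t k - x t k ≤ A := fun t ht k => by
  have := hx.reverse.sub_le hΓ hy.reverse (A := A) (by simpa using h) (T - t)
    ⟨by linarith [ht.2], by linarith [ht.1]⟩ k
  simpa using this

theorem le_sub_of_le_sub (hΓ : IsRepulsive (fun u => -Γ u) r) (hx : IsCellSolution Γ ω c x T)
    (hy : IsCellSolution Γ ω c y T) (h : ∀ k, A ≤ y T k - x T k) :
    ∀ t ∈ Icc 0 T, ∀ k, A ≤ y t k - x t k := fun t ht k => by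
  have := hy.sub_le_of_sub_le hΓ hx (A := -A) (fun k => by linarith [h k]) t ht k
  linarith

theorem exp_mul_sub_sub_le_of_le (hΓ : IsRepulsive (fun u => -Γ u) r) (hT : 0 ≤ T)
    (hx : IsCellSolution Γ ω c x T) (hy : IsCellSolution Γ ω c y T)
    (h : ∀ i j, (y T i - x T i) - (y T j - x T j) ≤ A) (i j : Fin N) :
    exp (r * T) * ((y 0 i - x 0 i) - (y 0 j - x 0 j)) ≤ A := by
  have := hx.reverse.exp_mul_sub_sub_le hΓ hy.reverse (A := A) (by simpa using h) T
    ⟨hT, le_rfl⟩ i j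
  simpa using this

end IsCellSolution

/-- For attractive coupling, a solution that never leaves its cell is phase-locked. -/
theorem IsNetworkSolution.phaseLocked_of_cell_eq {x : Fin N → ℝ} {θ : ℝ → Fin N → ℝ}
    (hp : Function.Periodic Γ (2 * π)) (hc : ContinuousOn Γ (Ioo 0 (2 * π)))
    (hΓ : IsRepulsive (fun u => -Γ u) r) (h : IsNetworkSolution Γ ω x θ)
    (hcell : ∀ t, 0 ≤ t → cell (θ t) = cell x) (i j : Fin N) :
    phaseVelocity Γ ω x i = phaseVelocity Γ ω x j := by
  have hsol : ∀ T, IsCellSolution Γ ω (cell x) θ T := fun T =>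
    h.isCellSolution hp hc fun t ht => hcell t ht.1.le
  -- Compare the solution with its shift by `s`. At time `T` both lie in the same cell, so the
  -- spread of the displacement is at most `2π`; contracting backwards to time `0` gains `exp (-(r *
  -- T))`, and `T` is arbitrary.
  have hle : ∀ s, 0 ≤ s → ∀ i j, (θ s i - x i) - (θ s j - x j) ≤ 0 := by
    intro s hs i j
    have hbound : ∀ T, 0 ≤ T → (θ s i - x i) - (θ s j - x j) ≤ 2 * π * exp (-(r * T)) := by
      intro T hT
      have h1 := (hsol T).exp_mul_sub_sub_le_of_le hΓ hT ((hsol (T + s)).shift hs le_rfl)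
        (A := 2 * π) (fun i j => by
          have h2 := lt_cell_add_one (θ (T + s)) i j
          have h3 := _root_.cell_le (θ T) i j
          rw [hcell _ (by linarith)] at h2
          rw [hcell _ hT] at h3
          linarith) i j
      rw [zero_add, h.apply_zero] at h1
      rw [exp_neg, ← div_eq_mul_inv, le_div_iff₀ (exp_pos _)]
      linarith
    have hlim : Tendsto (fun T => 2 * π * exp (-(r * T))) atTop (𝓝 0) := by
      have := (tendsto_exp_neg_atTop_nhds_zero.comp
        (tendsto_id.const_mul_atTop hΓ.pos)).const_mul (2 * π)
      simpa using this
    exact ge_of_tendsto hlim ((eventually_ge_atTop 0).mono hbound)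
  have hconst : ∀ s, 0 ≤ s → ∀ i j, θ s i - θ s j = x i - x j := fun s hs i j => by
    linarith [hle s hs i j, hle s hs j i]
  have hone : ∀ k, θ 1 k = x k + phaseVelocity Γ ω x k := by
    intro k
    rw [h.eq_integral 1 zero_le_one k]
    have : ∫ s in (0 : ℝ)..1, phaseVelocity Γ ω (θ s) k
        = ∫ _ in (0 : ℝ)..1, phaseVelocity Γ ω x k := by
      refine intervalIntegral.integral_congr fun s hs => ?_
      rw [uIcc_of_le zero_le_one] at hs
      exact phaseVelocity_congr_sub (hconst s hs.1) k
    rw [this]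
    simp
  have := hconst 1 zero_le_one i j
  rw [hone, hone] at this
  linarith

/-- Configurations that some solution carries, through `k` visits to the boundary of its cell, to a
phase-locked state that is not synchronized. -/
def lockingSet {N : ℕ} (Γ : ℝ → ℝ) (ω : ℝ) : ℕ → Set (Fin N → ℝ)
  | 0 => {x | (∀ i j, phaseVelocity Γ ω x i = phaseVelocity Γ ω x j) ∧
      ∃ i j, ¬ InPhase (x i) (x j)}
  | k + 1 => {x | ∃ (θ : ℝ → Fin N → ℝ) (τ : ℝ), IsNetworkSolution Γ ω x θ ∧ 0 < τ ∧
      (∀ t, 0 ≤ t → t < τ → cell (θ t) = cell x) ∧ θ τ ∈ lockingSet Γ ω k}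

theorem IsNetworkSolution.inPhase_of_inPhase {x : Fin N → ℝ} {θ : ℝ → Fin N → ℝ}
    (h : IsNetworkSolution Γ ω x θ) {t : ℝ} (ht : 0 ≤ t) {i j : Fin N} (hij : InPhase (x i) (x j)) :
    InPhase (θ t i) (θ t j) :=
  h.inPhase_forever 0 t le_rfl ht i j (by rwa [h.apply_zero])

/-- For attractive coupling, a solution synchronizes in finite time unless it starts in one of the
locking sets. -/
theorem IsNetworkSolution.synchronizes_or_mem_lockingSet (hp : Function.Periodic Γ (2 * π))
    (hc : ContinuousOn Γ (Ioo 0 (2 * π))) (hΓ : IsRepulsive (fun u => -Γ u) r)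
    {x : Fin N → ℝ} {θ : ℝ → Fin N → ℝ} (h : IsNetworkSolution Γ ω x θ) :
    (∃ T, 0 ≤ T ∧ ∀ t, T ≤ t → ∀ i j, InPhase (θ t i) (θ t j)) ∨
      ∃ k, k + 2 ≤ numClusters x ∧ x ∈ lockingSet Γ ω k := by
  induction hn : numClusters x using Nat.strong_induction_on generalizing x θ with
  | _ n ih =>
    subst hn
    rcases h.forall_cell_eq_or_exists with h1 | ⟨τ, hτ, h1, i, j, hij, hin⟩
    · by_cases hall : ∀ i j, InPhase (x i) (x j)
      · exact Or.inl ⟨0, le_rfl, fun t ht i j => h.inPhase_of_inPhase ht (hall i j)⟩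
      · push Not at hall
        obtain ⟨i, j, hij⟩ := hall
        exact Or.inr ⟨0, one_lt_numClusters hij, h.phaseLocked_of_cell_eq hp hc hΓ h1, i, j, hij⟩
    · have hlt : numClusters (θ τ) < numClusters x :=
        numClusters_lt (fun i j => h.inPhase_of_inPhase hτ.le) hij hin
      rcases ih _ hlt (h.shift hτ.le) rfl with ⟨T, hT, hsync⟩ | ⟨k, hk, hmem⟩
      · refine Or.inl ⟨T + τ, by linarith, fun t ht i j => ?_⟩
        have := hsync (t - τ) (by linarith) i j
        simpa using this
      -- The collision removes at least one cluster, which pays for the additional visit.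
      · exact Or.inr ⟨k + 1, by omega, θ, τ, h, hτ, h1, hmem⟩

/-- In each of the countably many cells, locked states differ by common rotations, so the phase of
oscillator `0` determines them. -/
theorem isThin_lockingSet_zero [NeZero N] (hΓ : IsRepulsive (fun u => -Γ u) r) :
    IsThin 1 (lockingSet (N := N) Γ ω 0) := by
  refine ⟨Fin N → Fin N → ℤ, inferInstance, fun c => {x | x ∈ lockingSet Γ ω 0 ∧ cell x = c},
    fun x hx => mem_iUnion.2 ⟨cell x, hx, rfl⟩, fun c => ⟨fun x _ => x 0, 1, zero_le_one, ?_⟩⟩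
  rintro x ⟨⟨hx, -⟩, hcx⟩ y ⟨⟨hy, -⟩, hcy⟩
  have key := hΓ.sub_eq_of_phaseLocked (ω := -ω) (hcy.trans hcx.symm)
    (fun i j => by rw [phaseVelocity_neg, phaseVelocity_neg, hy i j])
    (fun i j => by rw [phaseVelocity_neg, phaseVelocity_neg, hx i j])
  rw [one_mul]
  refine (dist_pi_le_iff dist_nonneg).2 fun k => ?_
  rw [Real.dist_eq, key k 0, ← Real.dist_eq]
  exact dist_le_pi_dist (fun _ : Fin 1 => x 0) (fun _ => y 0) 0

/-- Up to the first visit to the boundary of its cell, a solution moves at bounded speed on an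
initial time interval. -/
theorem IsNetworkSolution.exists_dist_le {x : Fin N → ℝ} {θ : ℝ → Fin N → ℝ} {τ : ℝ}
    (hp : Function.Periodic Γ (2 * π)) (hc : ContinuousOn Γ (Ioo 0 (2 * π)))
    (h : IsNetworkSolution Γ ω x θ) (hτ : 0 < τ)
    (hcell : ∀ t, 0 ≤ t → t < τ → cell (θ t) = cell x) :
    ∃ n : ℕ, ∀ s : ℝ, 0 ≤ s → s * (n + 1) ≤ 1 → dist (θ s) x ≤ n * s := by
  have hcont : ContinuousOn (fun t => phaseVelocity Γ ω (θ t)) (Icc 0 (τ / 2)) :=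
    continuousOn_pi.2 fun k => continuousOn_phaseVelocity hp hc
      (h.continuousOn.mono Icc_subset_Ici_self)
      (fun t ht => hcell t ht.1 (by linarith [ht.2])) k
  obtain ⟨M, hM⟩ := isCompact_Icc.exists_bound_of_continuousOn hcont
  obtain ⟨n, hn⟩ := exists_nat_ge (max M (2 / τ))
  refine ⟨n, fun s hs hsn => ?_⟩
  have hn1 : M ≤ n := (le_max_left _ _).trans hn
  have hn2 : 2 / τ ≤ n := (le_max_right _ _).trans hn
  have hsτ : s ≤ τ / 2 := by
    rw [div_le_iff₀ hτ] at hn2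
    by_contra! hlt
    have h1 := mul_lt_mul_of_pos_right hlt (show (0 : ℝ) < n + 1 by positivity)
    linarith
  refine (dist_pi_le_iff (by positivity)).2 fun k => ?_
  have hI := intervalIntegral.norm_integral_le_of_norm_le_const (a := 0) (b := s) (C := n)
    (f := fun u => phaseVelocity Γ ω (θ u) k) fun u hu => by
      rw [uIoc_of_le hs] at hu
      exact ((norm_le_pi_norm _ k).trans (hM u ⟨hu.1.le, hu.2.trans hsτ⟩)).trans hn1
  rw [Real.dist_eq, h.eq_integral s hs k, add_sub_cancel_left]
  simpa [abs_of_nonneg hs] using hI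

/-- Backward nonexpansiveness: the entrance point in `B` and the travel time determine the initial
condition in a Lipschitz way, locally. -/
theorem IsThin.preimage_solution {d : ℕ} {B : Set (Fin N → ℝ)} (hp : Function.Periodic Γ (2 * π))
    (hc : ContinuousOn Γ (Ioo 0 (2 * π))) (hΓ : IsRepulsive (fun u => -Γ u) r) (hB : IsThin d B) :
    IsThin (d + 1) {x | ∃ (θ : ℝ → Fin N → ℝ) (τ : ℝ), IsNetworkSolution Γ ω x θ ∧ 0 < τ ∧
      (∀ t, 0 ≤ t → t < τ → cell (θ t) = cell x) ∧ θ τ ∈ B} := by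
  obtain ⟨ι, _, A, hBA, hA⟩ := hB
  choose g C hC hg using hA
  set E : Set (Fin N → ℝ) := {x | ∃ (θ : ℝ → Fin N → ℝ) (τ : ℝ), IsNetworkSolution Γ ω x θ ∧
    0 < τ ∧ (∀ t, 0 ≤ t → t < τ → cell (θ t) = cell x) ∧ θ τ ∈ B} with hE
  choose! θ τ hθ hτ hcell hmem using fun (x : Fin N → ℝ) (hx : x ∈ E) => hx
  -- The pieces are indexed by the target piece, the cell, a bound `n` for the initial speed, and a
  -- time slot of length `1 / (n + 1)`, so that travel times within a piece differ by less than the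
  -- time for which the speed bound is valid.
  refine ⟨ι × (Fin N → Fin N → ℤ) × ℕ × ℤ, inferInstance, fun p => {x | x ∈ E ∧
    θ x (τ x) ∈ A p.1 ∧ cell x = p.2.1 ∧
    (∀ s : ℝ, 0 ≤ s → s * (p.2.2.1 + 1) ≤ 1 → dist (θ x s) x ≤ p.2.2.1 * s) ∧
    ⌊τ x * (p.2.2.1 + 1)⌋ = p.2.2.2}, fun x hx => ?_, ?_⟩
  · obtain ⟨i, hi⟩ := mem_iUnion.1 (hBA (hmem x hx))
    obtain ⟨n, hn⟩ := (hθ x hx).exists_dist_le hp hc (hτ x hx) (hcell x hx)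
    exact mem_iUnion.2 ⟨(i, cell x, n, ⌊τ x * (n + 1)⌋), hx, hi, rfl, hn, rfl⟩
  · rintro ⟨i, c, n, q⟩
    refine ⟨fun x => Fin.cons (τ x) (g i (θ x (τ x))), C i + n, by have := hC i; positivity, ?_⟩
    intro x hx y hy
    wlog hle : τ x ≤ τ y generalizing x y
    · rw [dist_comm x y, dist_comm (Fin.cons _ _)]
      exact this y hy x hx (le_of_not_ge hle)
    obtain ⟨hxE, hxA, hxc, -, hxq⟩ := hx
    obtain ⟨hyE, hyA, hyc, hyn, hyq⟩ := hy
    simp only at hxA hxc hxq hyA hyc hyn hyq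
    set δ := τ y - τ x with hδ
    have hδ0 : 0 ≤ δ := sub_nonneg.2 hle
    have hδ1 : δ * (n + 1) ≤ 1 := by
      have := Int.abs_sub_lt_one_of_floor_eq_floor (hyq.trans hxq.symm)
      rw [← sub_mul] at this
      exact (le_abs_self _).trans this.le
    have hX : IsCellSolution Γ ω c (θ x) (τ x) := (hθ x hxE).isCellSolution hp hc fun t ht =>
      (hcell x hxE t ht.1.le ht.2).trans hxc
    -- Skipping the first `δ` of the slower solution synchronizes the arrival times, so backward
    -- nonexpansiveness applies; the skipped stretch has length at most `n * δ`.
    have hY : IsCellSolution Γ ω c (fun t => θ y (t + δ)) (τ x) :=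
      ((hθ y hyE).isCellSolution hp hc (T := τ y) fun t ht =>
        (hcell y hyE t ht.1.le ht.2).trans hyc).shift hδ0 (by rw [hδ]; linarith)
    have hend : τ x + δ = τ y := by rw [hδ]; ring
    set a := dist (θ x (τ x)) (θ y (τ y)) with ha
    have hak : ∀ k, |θ x (τ x) k - θ y (τ y) k| ≤ a := fun k => by
      rw [← Real.dist_eq]; exact dist_le_pi_dist _ _ k
    have h0 : (0 : ℝ) ∈ Icc 0 (τ x) := ⟨le_rfl, (hτ x hxE).le⟩
    have h1 := hX.sub_le_of_sub_le hΓ hY (A := a)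
      (fun k => by rw [hend]; linarith [(abs_le.1 (hak k)).1]) 0 h0
    have h2 := hX.le_sub_of_le_sub hΓ hY (A := -a)
      (fun k => by rw [hend]; linarith [(abs_le.1 (hak k)).2]) 0 h0
    simp only [zero_add, (hθ x hxE).apply_zero] at h1 h2
    have h3 : dist x (θ y δ) ≤ a := (dist_pi_le_iff dist_nonneg).2 fun k => by
      rw [Real.dist_eq, abs_le]
      constructor <;> linarith [h1 k, h2 k]
    have h4 : dist (θ y δ) y ≤ n * δ := hyn δ hδ0 hδ1
    set G := dist (Fin.cons (τ x) (g i (θ x (τ x))) : Fin (d + 1) → ℝ)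
      (Fin.cons (τ y) (g i (θ y (τ y))))
    have h5 : δ ≤ G := by
      have := dist_le_pi_dist (Fin.cons (τ x) (g i (θ x (τ x))) : Fin (d + 1) → ℝ)
        (Fin.cons (τ y) (g i (θ y (τ y)))) 0
      rw [Fin.cons_zero, Fin.cons_zero, Real.dist_eq, abs_sub_comm] at this
      exact (le_abs_self _).trans this
    have h6 : dist (g i (θ x (τ x))) (g i (θ y (τ y))) ≤ G :=
      (dist_pi_le_iff dist_nonneg).2 fun k => by
        have := dist_le_pi_dist (Fin.cons (τ x) (g i (θ x (τ x))) : Fin (d + 1) → ℝ)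
          (Fin.cons (τ y) (g i (θ y (τ y)))) k.succ
        rwa [Fin.cons_succ, Fin.cons_succ] at this
    calc dist x y ≤ dist x (θ y δ) + dist (θ y δ) y := dist_triangle _ _ _
      _ ≤ C i * dist (g i (θ x (τ x))) (g i (θ y (τ y))) + n * δ :=
        add_le_add (h3.trans (hg i _ hxA _ hyA)) h4
      _ ≤ C i * G + n * G := add_le_add (mul_le_mul_of_nonneg_left h6 (hC i))
        (mul_le_mul_of_nonneg_left h5 n.cast_nonneg)
      _ = (C i + n) * G := by ring

theorem isThin_lockingSet [NeZero N] (hp : Function.Periodic Γ (2 * π))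
    (hc : ContinuousOn Γ (Ioo 0 (2 * π))) (hΓ : IsRepulsive (fun u => -Γ u) r) (k : ℕ) :
    IsThin (k + 1) (lockingSet (N := N) Γ ω k) := by
  induction k with
  | zero => exact isThin_lockingSet_zero hΓ
  | succ k ih => exact ih.preimage_solution hp hc hΓ

theorem ae_synchronizes [NeZero N] (hp : Function.Periodic Γ (2 * π))
    (hc : ContinuousOn Γ (Ioo 0 (2 * π))) (hΓ : IsRepulsive (fun u => -Γ u) r) (ω : ℝ) :
    ∀ᵐ x : Fin N → ℝ, ∀ θ : ℝ → Fin N → ℝ, IsNetworkSolution Γ ω x θ →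
      ∃ T, 0 ≤ T ∧ ∀ t, T ≤ t → ∀ i j, InPhase (θ t i) (θ t j) := by
  have h : ∀ᵐ x : Fin N → ℝ, ∀ k, k + 2 ≤ N → x ∉ lockingSet Γ ω k := by
    refine ae_all_iff.2 fun k => ?_
    by_cases hk : k + 2 ≤ N
    · filter_upwards [measure_eq_zero_iff_ae_notMem.1
        ((isThin_lockingSet (ω := ω) hp hc hΓ k).volume_eq_zero (show k + 1 < N by omega))]
        with x hx _ using hx
    · exact Eventually.of_forall fun x h => absurd h hk
  filter_upwards [h] with x hx θ hθ
  refine (hθ.synchronizes_or_mem_lockingSet hp hc hΓ).resolve_right ?_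
  rintro ⟨k, hk, hmem⟩
  exact hx k (hk.trans (numClusters_le x)) hmem

/-- There are fewer synchronization times than oscillators. -/
theorem IsNetworkSolution.encard_synchronizationTimes_le [NeZero N] {x : Fin N → ℝ}
    {θ : ℝ → Fin N → ℝ} (h : IsNetworkSolution Γ ω x θ) :
    (synchronizationTimes θ).encard ≤ ((N - 1 : ℕ) : ℕ∞) := by
  have hlt : ∀ s t, 0 ≤ s → s < t → t ∈ synchronizationTimes θ →
      numClusters (θ t) < numClusters (θ s) := by
    rintro s t hs hst ⟨-, i, j, hin, hout⟩
    exact numClusters_lt (fun i j => h.inPhase_forever s t hs hst.le i j) (hout s hs hst) hin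
  have hinj : InjOn (fun t => numClusters (θ t)) (synchronizationTimes θ) := by
    intro s hs t ht hst
    rcases lt_trichotomy s t with h1 | h1 | h1
    · exact absurd hst (hlt s t hs.1.le h1 ht).ne'
    · exact h1
    · exact absurd hst (hlt t s ht.1.le h1 hs).ne
  -- The cluster count drops strictly at every synchronization time, starting from at most `N` and
  -- remaining positive.
  have hmaps : MapsTo (fun t => numClusters (θ t)) (synchronizationTimes θ)
      (Finset.Icc 1 (N - 1) : Finset ℕ) := by
    intro t ht
    have h1 := hlt 0 t le_rfl ht.1 ht
    have h2 := numClusters_le (θ 0)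
    have h3 : 0 < numClusters (θ t) :=
      (Set.ncard_pos (Set.finite_range _)).2 ⟨_, 0, rfl⟩
    simp only [Finset.coe_Icc, mem_Icc]
    omega
  refine (Set.encard_le_encard_of_injOn hmaps hinj).trans ?_
  rw [Set.encard_coe_eq_coe_finsetCard, Nat.card_Icc]
  simp

end

/-! ### Increasing coupling: existence by continuation through collisions -/

/-- A bounded function whose derivative is bounded on one side has a limit at the end of an
interval. -/
theorem exists_tendsto_of_deriv_bound {f f' : ℝ → ℝ} {τ B C : ℝ} (hτ : 0 < τ)
    (hd : ∀ t ∈ Ioo 0 τ, HasDerivAt f (f' t) t) (hB : ∀ t ∈ Ioo 0 τ, |f t| ≤ B)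
    (hC : (∀ t, -C ≤ f' t) ∨ ∀ t, f' t ≤ C) : ∃ l, Tendsto f (𝓝[<] τ) (𝓝 l) := by
  have key : ∀ {f f' : ℝ → ℝ}, (∀ t ∈ Ioo 0 τ, HasDerivAt f (f' t) t) →
      (∀ t ∈ Ioo 0 τ, |f t| ≤ B) → (∀ t, -C ≤ f' t) → ∃ l, Tendsto f (𝓝[<] τ) (𝓝 l) := by
    intro f f' hd hB hC
    -- Adding `C * t` makes the function monotone, and it remains bounded.
    have hg : ∀ t ∈ Ioo 0 τ, HasDerivAt (fun t => f t + C * t) (f' t + C) t := fun t ht => by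
      have := (hd t ht).add ((hasDerivAt_id t).const_mul C)
      rw [mul_one] at this
      exact this
    have hmono : MonotoneOn (fun t => f t + C * t) (Ioo 0 τ) := by
      refine monotoneOn_of_deriv_nonneg (convex_Ioo _ _)
        (fun t ht => (hg t ht).continuousAt.continuousWithinAt) ?_ ?_
      · rw [interior_Ioo]
        exact fun t ht => (hg t ht).differentiableAt.differentiableWithinAt
      · rw [interior_Ioo]
        intro t ht
        rw [(hg t ht).deriv]
        linarith [hC t]
    have hbdd : BddAbove ((fun t => f t + C * t) '' Ioo 0 τ) := by
      refine ⟨B + |C| * τ, ?_⟩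
      rintro _ ⟨t, ht, rfl⟩
      have h1 := (abs_le.1 (hB t ht)).2
      have h2 : C * t ≤ |C| * τ := mul_le_mul (le_abs_self C) ht.2.le ht.1.le (abs_nonneg C)
      exact add_le_add h1 h2
    have h1 := hmono.tendsto_nhdsWithin_Ioo_left (nonempty_Ioo.2 hτ) hbdd
    have h2 : Tendsto (fun t : ℝ => C * t) (𝓝[<] τ) (𝓝 (C * τ)) :=
      (Continuous.tendsto (by fun_prop) τ).mono_left nhdsWithin_le_nhds
    have h3 := h1.sub h2
    simp only [add_sub_cancel_right] at h3
    exact ⟨_, h3⟩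
  rcases hC with hC | hC
  · exact key hd hB hC
  · obtain ⟨l, hl⟩ := key (f := fun t => -f t) (f' := fun t => -f' t)
      (fun t ht => (hd t ht).neg) (fun t ht => by rw [abs_neg]; exact hB t ht)
      (fun t => neg_le_neg (hC t))
    exact ⟨-l, by simpa using hl.neg⟩

/-- A derivative that is bounded on one side is integrable. -/
theorem intervalIntegrable_of_deriv_bound {f f' : ℝ → ℝ} {τ C : ℝ} (hτ : 0 < τ)
    (hc : ContinuousOn f (Icc 0 τ)) (hd : ∀ t ∈ Ioo 0 τ, HasDerivAt f (f' t) t)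
    (hC : (∀ t, -C ≤ f' t) ∨ ∀ t, f' t ≤ C) : IntervalIntegrable f' volume 0 τ := by
  have key : ∀ {f f' : ℝ → ℝ}, ContinuousOn f (Icc 0 τ) →
      (∀ t ∈ Ioo 0 τ, HasDerivAt f (f' t) t) → (∀ t, -C ≤ f' t) →
      IntervalIntegrable f' volume 0 τ := by
    intro f f' hc hd hC
    have h1 : IntervalIntegrable (fun t => f' t + C) volume 0 τ := by
      refine intervalIntegral.intervalIntegrable_deriv_of_nonneg (g := fun t => f t + C * t) ?_ ?_ ?_
      · rw [uIcc_of_le hτ.le]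
        exact hc.add (by fun_prop)
      · rw [min_eq_left hτ.le, max_eq_right hτ.le]
        intro t ht
        have := (hd t ht).add ((hasDerivAt_id t).const_mul C)
        rw [mul_one] at this
        exact this
      · exact fun t _ => by linarith [hC t]
    simpa using h1.sub (intervalIntegrable_const (c := C))
  rcases hC with hC | hC
  · exact key hc hd hC
  · have := key (f := fun t => -f t) (f' := fun t => -f' t) hc.neg
      (fun t ht => (hd t ht).neg) (fun t => neg_le_neg (hC t))
    exact this.neg.congr fun t _ => neg_neg (f' t)

section

variable {N : ℕ} {Γ : ℝ → ℝ} {ω r τ : ℝ} {c : Fin N → Fin N → ℤ} {y : ℝ → Fin N → ℝ}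

theorem IsMonotoneCoupling.exists_phaseVelocity_bound (h : IsMonotoneCoupling Γ)
    (hcurv : HasCurvatureOfConstantSign Γ) (N : ℕ) (ω : ℝ) :
    ∃ C, (∀ (x : Fin N → ℝ) k, -C ≤ phaseVelocity Γ ω x k) ∨
      ∀ (x : Fin N → ℝ) k, phaseVelocity Γ ω x k ≤ C := by
  obtain ⟨C, hC⟩ := h.exists_bound hcurv
  refine ⟨|ω - Γ 0| + N * C, ?_⟩
  simp only [phaseVelocity_eq]
  rcases hC with hC | hC
  · refine Or.inl fun x k => ?_
    have := Finset.card_nsmul_le_sum Finset.univ (fun j => Γ (x k - x j)) (-C) fun j _ => hC _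
    rw [nsmul_eq_mul, Finset.card_univ, Fintype.card_fin] at this
    linarith [neg_abs_le (ω - Γ 0)]
  · refine Or.inr fun x k => ?_
    have := Finset.sum_le_card_nsmul Finset.univ (fun j => Γ (x k - x j)) C fun j _ => hC _
    rw [nsmul_eq_mul, Finset.card_univ, Fintype.card_fin] at this
    linarith [le_abs_self (ω - Γ 0)]

/-- Attractive coupling does not make the phases blow up in finite time. -/
theorem IsCellSolution.exists_abs_le (hΓ : IsRepulsive (fun u => -Γ u) r) (hτ : 0 < τ)
    (hy : ∀ T < τ, IsCellSolution Γ ω c y T) :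
    ∃ B, ∀ t ∈ Ioo 0 τ, ∀ k, |y t k| ≤ B := by
  have hT : τ / 2 < τ := by linarith
  obtain ⟨M, hM⟩ := isCompact_Icc.exists_bound_of_continuousOn (hy _ hT).continuousOn
  have hMk : ∀ t ∈ Icc 0 (τ / 2), ∀ k, |y t k| ≤ M := fun t ht k =>
    (norm_le_pi_norm (y t) k).trans (hM t ht)
  obtain ⟨R, hR⟩ := (Set.finite_range fun p : Fin N × Fin N =>
    2 * π * ((c p.1 p.2 : ℝ) + 1)).bddAbove
  refine ⟨3 * M + |R|, fun t ht k => ?_⟩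
  have : Nonempty (Fin N) := ⟨k⟩
  have hM0 : 0 ≤ M := (abs_nonneg _).trans (hMk 0 ⟨le_rfl, by linarith⟩ k)
  have hR0 := abs_nonneg R
  rcases le_total t (τ / 2) with hle | hle
  · linarith [hMk t ⟨ht.1.le, hle⟩ k]
  have hspread : ∀ i j, y t i - y t j ≤ |R| := fun i j => by
    have h1 := lt_cell_add_one (y t) i j
    rw [(hy ((t + τ) / 2) (by linarith [ht.2])).cell_eq t ⟨ht.1, by linarith [ht.2]⟩] at h1
    exact h1.le.trans ((hR ⟨(i, j), rfl⟩).trans (le_abs_self R))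
  -- Compare the solution on `[0, τ/2]` with its shift by `s`. Backwards, the extreme displacements
  -- at the end bound the displacement at the start, which is at most `2 * M`. So some phase at time
  -- `t` is at most `3 * M` and some is at least `-3 * M`; the cell bounds the spread around them.
  set s := t - τ / 2
  have hs : 0 ≤ s := sub_nonneg.2 hle
  have hs' : s ≤ τ / 2 := by simp only [s]; linarith [ht.2]
  have hst : τ / 2 + s = t := by simp only [s]; ring
  have hY : IsCellSolution Γ ω c (fun u => y (u + s)) (τ / 2) := (hy t ht.2).shift hs hst.le
  have hX := hy _ hT
  have h0 : (0 : ℝ) ∈ Icc 0 (τ / 2) := ⟨le_rfl, by linarith⟩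
  have hT' : τ / 2 ∈ Icc 0 (τ / 2) := ⟨by linarith, le_rfl⟩
  obtain ⟨i, hi⟩ := Finite.exists_min fun k => y t k - y (τ / 2) k
  obtain ⟨j, hj⟩ := Finite.exists_max fun k => y t k - y (τ / 2) k
  have h1 := hX.le_sub_of_le_sub hΓ hY (A := y t i - y (τ / 2) i)
    (fun k => by rw [hst]; exact hi k) 0 h0 k
  have h2 := hX.sub_le_of_sub_le hΓ hY (A := y t j - y (τ / 2) j)
    (fun k => by rw [hst]; exact hj k) 0 h0 k
  simp only [zero_add] at h1 h2
  have e0 := abs_le.1 (hMk 0 h0 k)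
  have es := abs_le.1 (hMk s ⟨hs, hs'⟩ k)
  have ei := abs_le.1 (hMk (τ / 2) hT' i)
  have ej := abs_le.1 (hMk (τ / 2) hT' j)
  rw [abs_le]
  constructor <;> linarith [hspread k i, hspread j k]

/-- A solution in a cell that is bounded on one side in velocity extends to its exit time. -/
theorem IsCellSolution.exists_extension (hΓ : IsRepulsive (fun u => -Γ u) r) (hτ : 0 < τ)
    (hy : ∀ T < τ, IsCellSolution Γ ω c y T) {C : ℝ}
    (hC : (∀ (x : Fin N → ℝ) k, -C ≤ phaseVelocity Γ ω x k) ∨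
      ∀ (x : Fin N → ℝ) k, phaseVelocity Γ ω x k ≤ C) :
    ∃ z : ℝ → Fin N → ℝ, (∀ t, t < τ → z t = y t) ∧ IsCellSolution Γ ω c z τ ∧
      ∀ k, IntervalIntegrable (fun t => phaseVelocity Γ ω (z t) k) volume 0 τ := by
  obtain ⟨B, hB⟩ := IsCellSolution.exists_abs_le hΓ hτ hy
  have hmid : ∀ t < τ, t < (t + τ) / 2 ∧ (t + τ) / 2 < τ := fun t ht =>
    ⟨by linarith, by linarith⟩
  have hd : ∀ t ∈ Ioo 0 τ, ∀ k, HasDerivAt (fun s => y s k) (phaseVelocity Γ ω (y t) k) t :=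
    fun t ht => (hy _ (hmid t ht.2).2).hasDerivAt t ⟨ht.1, (hmid t ht.2).1⟩
  have hlim : ∀ k, ∃ l, Tendsto (fun s => y s k) (𝓝[<] τ) (𝓝 l) := fun k =>
    exists_tendsto_of_deriv_bound hτ (fun t ht => hd t ht k) (fun t ht => hB t ht k)
      (hC.imp (fun h t => h (y t) k) (fun h t => h (y t) k))
  choose l hl using hlim
  have heq : ∀ t, t < τ → Function.update y τ l t = y t := fun t ht =>
    Function.update_of_ne ht.ne _ _
  have hsol : IsCellSolution Γ ω c (Function.update y τ l) τ := by
    refine ⟨?_, fun t ht => ?_, fun t ht k => ?_⟩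
    · rw [continuousOn_update_iff, Icc_sdiff_right]
      refine ⟨fun t ht => ?_, fun _ => ?_⟩
      · have h1 := (hy _ (hmid t ht.2).2).continuousOn t ⟨ht.1, (hmid t ht.2).1.le⟩
        refine h1.mono_of_mem_nhdsWithin ?_
        exact mem_nhdsWithin.2 ⟨Iio ((t + τ) / 2), isOpen_Iio, (hmid t ht.2).1,
          fun s hs => ⟨hs.2.1, hs.1.le⟩⟩
      · rw [nhdsWithin_Ico_eq_nhdsLT hτ]
        exact tendsto_pi_nhds.2 hl
    · rw [heq t ht.2]
      exact (hy _ (hmid t ht.2).2).cell_eq t ⟨ht.1, (hmid t ht.2).1⟩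
    · rw [heq t ht.2]
      refine (hd t ht k).congr_of_eventuallyEq ?_
      filter_upwards [isOpen_Ioo.mem_nhds ht] with s hs
      rw [heq s hs.2]
  exact ⟨_, heq, hsol, fun k => intervalIntegrable_of_deriv_bound hτ (hsol.continuousOn_apply k)
    (fun t ht => hsol.hasDerivAt t ht k) (hC.imp (fun h t => h _ k) (fun h t => h _ k))⟩

/-- A curve that stays in a cell up to and including its end keeps away from the walls. -/
theorem IsCellSolution.exists_forall_mem_cellCore {x : Fin N → ℝ} (hτ : 0 < τ)
    (hy : IsCellSolution Γ ω (cell x) y τ) (h0 : y 0 = x) (h1 : cell (y τ) = cell x) :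
    ∃ m, 0 < m ∧ m ≤ π ∧ ∀ t ∈ Icc 0 τ, y t ∈ cellCore x m := by
  have hcell : ∀ t ∈ Icc 0 τ, cell (y t) = cell x := by
    intro t ht
    rcases eq_or_lt_of_le ht.1 with rfl | h2
    · rw [h0]
    rcases eq_or_lt_of_le ht.2 with rfl | h3
    · exact h1
    exact hy.cell_eq t ⟨h2, h3⟩
  have hpair : ∀ p : Fin N × Fin N, ∃ m, 0 < m ∧ (¬ InPhase (x p.1) (x p.2) →
      ∀ t ∈ Icc 0 τ, y t p.1 - y t p.2 - 2 * π * cell x p.1 p.2 ∈ Icc m (2 * π - m)) := by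
    rintro ⟨i, j⟩
    by_cases hij : InPhase (x i) (x j)
    · exact ⟨1, one_pos, fun h => absurd hij h⟩
    set u : ℝ → ℝ := fun t => y t i - y t j - 2 * π * cell x i j
    have hu : ContinuousOn u (Icc 0 τ) :=
      ((hy.continuousOn_apply i).sub (hy.continuousOn_apply j)).sub continuousOn_const
    have hmem : ∀ t ∈ Icc 0 τ, u t ∈ Ioo 0 (2 * π) := fun t ht => by
      have := sub_cell_mem_Ioo (mt (inPhase_congr (hcell t ht)).1 hij)
      rwa [hcell t ht] at this
    obtain ⟨s, hs, hmin⟩ := isCompact_Icc.exists_isMinOn ⟨0, le_rfl, hτ.le⟩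
      (hu.inf (continuousOn_const.sub hu : ContinuousOn (fun t => 2 * π - u t) _))
    refine ⟨min (u s) (2 * π - u s), lt_min (hmem s hs).1 (by linarith [(hmem s hs).2]),
      fun _ t ht => ?_⟩
    have h2 : min (u s) (2 * π - u s) ≤ min (u t) (2 * π - u t) := hmin ht
    exact ⟨h2.trans (min_le_left _ _), by linarith [h2.trans (min_le_right _ _)]⟩
  choose m hm0 hm using hpair
  obtain ⟨q, hq0, hq⟩ := exists_pos_le_of_forall_pos hm0
  refine ⟨min q π, lt_min hq0 pi_pos, min_le_right _ _, fun t ht => ⟨fun i j hij => ?_,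
    fun i j hij => ?_⟩⟩
  · have h2 := (inPhase_congr (hcell t ht)).2 hij
    rw [inPhase_iff_sub_eq_cell.1 h2, inPhase_iff_sub_eq_cell.1 hij, hcell t ht]
  · have h4 := hm (i, j) hij t ht
    have h5 := (min_le_left q π).trans (hq (i, j))
    exact ⟨h5.trans h4.1, by linarith [h4.2]⟩

/-- For attractive coupling, every initial condition has a solution. -/
theorem IsMonotoneCoupling.exists_isNetworkSolution (h : IsMonotoneCoupling Γ)
    (hcurv : HasCurvatureOfConstantSign Γ) (hΓ : IsRepulsive (fun u => -Γ u) r) (ω : ℝ)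
    (x : Fin N → ℝ) : ∃ θ, IsNetworkSolution Γ ω x θ := by
  induction hn : numClusters x using Nat.strong_induction_on generalizing x with
  | _ n ih =>
    subst hn
    obtain ⟨y, hy0, hy | ⟨τ, hτ, hy, hexit⟩⟩ := h.exists_isCellSolution hcurv ω x
    · refine ⟨y, ?_⟩
      rw [← hy0] at hy ⊢
      exact IsCellSolution.isNetworkSolution h.periodic h.continuousOn hy
    obtain ⟨C, hC⟩ := h.exists_phaseVelocity_bound hcurv N ω
    obtain ⟨z, hzy, hz, hint⟩ := IsCellSolution.exists_extension hΓ hτ hy hC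
    have hz0 : z 0 = x := (hzy 0 hτ).trans hy0
    have hτm : τ ∈ Icc 0 τ := ⟨hτ.le, le_rfl⟩
    have hkeep : ∀ i j, InPhase (x i) (x j) → InPhase (z τ i) (z τ j) := fun i j hij =>
      hz.inPhase hτ (inPhase_iff_cell.1 hij) hτm
    -- Were no new pair in phase at `τ`, the curve would stay in one core on the compact interval,
    -- contradicting its exit from every core.
    have hnew : ∃ i j, ¬ InPhase (x i) (x j) ∧ InPhase (z τ i) (z τ j) := by
      by_contra! hcon
      have hcell : cell (z τ) = cell x := cell_eq_of_forall_le
        (fun i j => hz.cell_le hτ i j τ hτm) fun i j hin => by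
          by_contra hx
          exact hcon i j hx hin
      obtain ⟨m, hm0, hm1, hm⟩ := hz.exists_forall_mem_cellCore hτ hz0 hcell
      obtain ⟨t, ht, hty⟩ := hexit m hm0 hm1
      rw [← hzy t ht.2] at hty
      exact hty (hm t ⟨ht.1, ht.2.le⟩)
    obtain ⟨i, j, hij, hin⟩ := hnew
    obtain ⟨θ, hθ⟩ := ih _ (numClusters_lt hkeep hij hin) (z τ) rfl
    rw [← hz0] at hz ⊢
    exact hz.exists_isNetworkSolution hτ hint hθ

end

/-! ### The main theorem -/

theorem theorem2 (N : ℕ) [NeZero N] (ω : ℝ) (Γ : ℝ → ℝ)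
    (hΓ : IsMonotoneCoupling Γ) (hcurv : HasCurvatureOfConstantSign Γ) :
    (StrictAntiOn Γ (Ioo 0 (2 * π)) →
      -- the splay state is the only phase-locked state with ordered, distinct phases
      (∀ ψ : Fin N → ℝ, StrictMono ψ → (∀ k, ψ k < ψ 0 + 2 * π) →
        ((∀ k, phaseVelocity Γ ω ψ k = phaseVelocity Γ ω ψ 0) ↔
          ∀ k : Fin N, ψ k - ψ 0 = 2 * π * (k : ℕ) / N)) ∧
      -- almost every initial condition leads to it; `σ` labels the oscillators in phase order,
      -- starting from the reference oscillator `0`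
      ∀ᵐ θ₀ : Fin N → ℝ,
        (∃ θ : ℝ → Fin N → ℝ, IsNetworkSolution Γ ω θ₀ θ) ∧
        ∃ σ : Equiv.Perm (Fin N), σ 0 = 0 ∧
          StrictMono (fun k => phaseDiff (θ₀ (σ k)) (θ₀ 0)) ∧
          ∀ θ : ℝ → Fin N → ℝ, IsNetworkSolution Γ ω θ₀ θ →
            ∀ k : Fin N, Tendsto (fun t => phaseDiff (θ t (σ k)) (θ t 0)) atTop
              (𝓝 (2 * π * (k : ℕ) / N))) ∧
    (StrictMonoOn Γ (Ioo 0 (2 * π)) →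
      ∀ᵐ θ₀ : Fin N → ℝ,
        (∃ θ : ℝ → Fin N → ℝ, IsNetworkSolution Γ ω θ₀ θ) ∧
        ∀ θ : ℝ → Fin N → ℝ, IsNetworkSolution Γ ω θ₀ θ →
          (∃ T : ℝ, 0 ≤ T ∧ ∀ t, T ≤ t → ∀ i j, InPhase (θ t i) (θ t j)) ∧
          (synchronizationTimes θ).encard ≤ ((N - 1 : ℕ) : ℕ∞)) := by
  obtain ⟨n, rfl⟩ := Nat.exists_eq_succ_of_ne_zero (NeZero.ne N)
  refine ⟨fun hanti => ?_, fun hmono => ?_⟩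
  · obtain ⟨c, hrep⟩ := hΓ.exists_isRepulsive hcurv hanti
    exact ⟨fun ψ hψ hψ' => hrep.phaseLocked_iff_splay ⟨hψ, hψ'⟩,
      hΓ.ae_tendsto_splay hcurv hrep ω⟩
  · obtain ⟨c, hrep⟩ := hΓ.neg.exists_isRepulsive hcurv.neg hmono.neg
    filter_upwards [ae_synchronizes hΓ.periodic hΓ.continuousOn hrep ω] with x hx
    exact ⟨hΓ.exists_isNetworkSolution hcurv hrep ω x,
      fun θ hθ => ⟨hx θ hθ, hθ.encard_synchronizationTimes_le⟩⟩
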